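/- **Theorem 5.3 (Evolution of scalar curvature).** Let $M$ be a smooth manifold of dimension $n$ (without boundary) and let $T\in\mathbb R$. For $t\in[0,T)$ let $g(t)$ be a Riemannian metric, $A(t)$ a 1-form and $B(t)$ a 2-form on $M$, depending smoothly on $(x,t)\in M\times[0,T)$, with field strengths $F=dA$ and $H=dB$, i.e. in local coordinates $$F_{ij}=\partial_iA_j-\partial_jA_i,\qquad H_{ijk}=\partial_iB_{jk}+\partial_jB_{ki}+\partial_kB_{ij}.$$ Suppose that they solve, in every local coordinate system, the coupled flow $$\frac{\partial g_{ij}}{\partial t}=-2\Big(R_{ij}-\tfrac14H_{ikl}H_j{}^{kl}-F_i{}^{k}F_{jk}\Big),\qquad \frac{\partial A_i}{\partial t}=-\nabla_kF_i{}^{k},\qquad \frac{\partial B_{ij}}{\partial t}=\nabla_kH^{k}{}_{ij}.$$ Here $\nabla$ is the Levi-Civita connection of $g(t)$ with Christoffel symbols $\Gamma^k_{ij}$, indices are raised with $g(t)$, and the curvature conventions are $$R^{k}_{ijl}=\partial_i\Gamma^k_{jl}-\partial_j\Gamma^k_{il}+\Gamma^k_{ip}\Gamma^p_{jl}-\Gamma^k_{jp}\Gamma^p_{il},\quad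 R_{ijkl}=g_{kp}R^p_{ijl},\quad R_{ik}=g^{jl}R_{ijkl},\quad R=g^{ij}R_{ij}.$$ Then in every local coordinate system, at every point of it and at every $t\in[0,T)$, the scalar curvature $R$ of $g(t)$ is differentiable in $t$ (one-sided at $t=0$, as in the flow equations) and $$\begin{aligned}\frac{\partial R}{\partial t}={}&\Delta R+2|\mathrm{Ric}|^2+\tfrac12g^{jl}g^{ik}\big[\nabla_i\nabla_l(H_{kpq}H_j{}^{pq})-\nabla_i\nabla_k(H_{jpq}H_l{}^{pq})\big]\\&+2g^{jl}g^{ik}\big[\nabla_i\nabla_l(F_k{}^{p}F_{jp})-\nabla_i\nabla_k(F_j{}^{p}F_{lp})\big]-g^{ip}R_{ik}\Big(\tfrac12H_{pmn}H^{kmn}+2F_{pm}F^{km}\Big),\end{aligned}$$ where $\Delta=g^{ij}\nabla_i\nabla_j$, $|\mathrm{Ric}|^2=g^{ik}g^{jl}R_{ij}R_{kl}$, and $\nabla_i\nabla_l S_{kj}$ denotes the component $\nabla_i(\nabla_l S_{kj})$ of the second covariant derivative of a covariant 2-tensor $S$. -/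

import Mathlib

open Set
open scoped Manifold ContDiff

noncomputable section

namespace GaugeRicciFlow

/-! ### Tensor calculus in coordinates

`Coord n` is the coordinate space.  A tensor with covariant indices is given by its components,
which are real functions of the coordinates; `G` denotes the components of a Riemannian metric. -/

/-- The coordinate space of dimension `n`. -/
abbrev Coord (n : ℕ) : Type := EuclideanSpace ℝ (Fin n)

variable {n : ℕ}

/-- The `i`-th coordinate vector. -/
def coordVec (i : Fin n) : Coord n := EuclideanSpace.single i (1 : ℝ)

/-- The partial derivative `∂f/∂xⁱ` at `y`. -/
def pd (i : Fin n) (f : Coord n → ℝ) (y : Coord n) : ℝ := fderiv ℝ f y (coordVec i)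

/-- The inverse metric `g^{ij}`. -/
def ginv (G : Fin n → Fin n → Coord n → ℝ) (i j : Fin n) (y : Coord n) : ℝ :=
  (Matrix.of fun a b => G a b y)⁻¹ i j

/-- The Christoffel symbols
`Γ^k_{ij} = ½ g^{kl} (∂_i g_{jl} + ∂_j g_{il} - ∂_l g_{ij})`. -/
def christoffel (G : Fin n → Fin n → Coord n → ℝ) (k i j : Fin n) (y : Coord n) : ℝ :=
  (1 / 2 : ℝ) * ∑ l, ginv G k l y * (pd i (G j l) y + pd j (G i l) y - pd l (G i j) y)

/-- The curvature
`R^k_{ijl} = ∂_i Γ^k_{jl} - ∂_j Γ^k_{il} + Γ^k_{ip} Γ^p_{jl} - Γ^k_{jp} Γ^p_{il}`. -/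
def riemannUp (G : Fin n → Fin n → Coord n → ℝ) (k i j l : Fin n) (y : Coord n) : ℝ :=
  pd i (christoffel G k j l) y - pd j (christoffel G k i l) y
    + ∑ p, (christoffel G k i p y * christoffel G p j l y
        - christoffel G k j p y * christoffel G p i l y)

/-- The curvature with lowered index, `R_{ijkl} = g_{kp} R^p_{ijl}`. -/
def riemann (G : Fin n → Fin n → Coord n → ℝ) (i j k l : Fin n) (y : Coord n) : ℝ :=
  ∑ p, G k p y * riemannUp G p i j l y

/-- The Ricci curvature `R_{ik} = g^{jl} R_{ijkl}`. -/
def ricci (G : Fin n → Fin n → Coord n → ℝ) (i k : Fin n) (y : Coord n) : ℝ :=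
  ∑ j, ∑ l, ginv G j l y * riemann G i j k l y

/-- The scalar curvature `R = g^{ij} R_{ij}`. -/
def scalarCurv (G : Fin n → Fin n → Coord n → ℝ) (y : Coord n) : ℝ :=
  ∑ i, ∑ j, ginv G i j y * ricci G i j y

/-- `|Ric|² = g^{ik} g^{jl} R_{ij} R_{kl}`. -/
def ricciNormSq (G : Fin n → Fin n → Coord n → ℝ) (y : Coord n) : ℝ :=
  ∑ i, ∑ j, ∑ k, ∑ l, ginv G i k y * ginv G j l y * ricci G i j y * ricci G k l y

/-- The Laplace-Beltrami operator `Δf = g^{ij} ∇_i ∇_j f`,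
where `∇_i ∇_j f = ∂_i ∂_j f - Γ^k_{ij} ∂_k f`. -/
def laplacian (G : Fin n → Fin n → Coord n → ℝ) (f : Coord n → ℝ) (y : Coord n) : ℝ :=
  ∑ i, ∑ j, ginv G i j y * (pd i (pd j f) y - ∑ k, christoffel G k i j y * pd k f y)

/-- The covariant derivative `∇_k T_{ij}` of a covariant 2-tensor, for the Levi-Civita connection;
the index of the derivative comes first. -/
def nabla₂ (G : Fin n → Fin n → Coord n → ℝ) (T : Fin n → Fin n → Coord n → ℝ)
    (k i j : Fin n) (y : Coord n) : ℝ :=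
  pd k (T i j) y
    - ∑ m, (christoffel G m k i y * T m j y + christoffel G m k j y * T i m y)

/-- The covariant derivative `∇_l T_{ijk}` of a covariant 3-tensor;
the index of the derivative comes first. -/
def nabla₃ (G : Fin n → Fin n → Coord n → ℝ) (T : Fin n → Fin n → Fin n → Coord n → ℝ)
    (l i j k : Fin n) (y : Coord n) : ℝ :=
  pd l (T i j k) y
    - ∑ m, (christoffel G m l i y * T m j k y + christoffel G m l j y * T i m k y
        + christoffel G m l k y * T i j m y)

/-- The second covariant derivative `∇_i ∇_l T_{kj} = ∇_i (∇_l T_{kj})` of a covariant 2-tensor. -/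
def nablaNabla (G : Fin n → Fin n → Coord n → ℝ) (T : Fin n → Fin n → Coord n → ℝ)
    (i l k j : Fin n) (y : Coord n) : ℝ :=
  nabla₃ G (nabla₂ G T) i l k j y

/-- The field strength `F = dA`, i.e. `F_{ij} = ∂_i A_j - ∂_j A_i`. -/
def fieldF (A : Fin n → Coord n → ℝ) (i j : Fin n) (y : Coord n) : ℝ :=
  pd i (A j) y - pd j (A i) y

/-- The field strength `H = dB`, i.e. `H_{ijk} = ∂_i B_{jk} + ∂_j B_{ki} + ∂_k B_{ij}`. -/
def fieldH (B : Fin n → Fin n → Coord n → ℝ) (i j k : Fin n) (y : Coord n) : ℝ :=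
  pd i (B j k) y + pd j (B k i) y + pd k (B i j) y

/-- `H_{ipq} H_j^{pq} = g^{pr} g^{qs} H_{ipq} H_{jrs}`. -/
def contrH (G : Fin n → Fin n → Coord n → ℝ) (H : Fin n → Fin n → Fin n → Coord n → ℝ)
    (i j : Fin n) (y : Coord n) : ℝ :=
  ∑ p, ∑ q, ∑ r, ∑ s, ginv G p r y * ginv G q s y * H i p q y * H j r s y

/-- `F_i^p F_{jp} = g^{pq} F_{iq} F_{jp}`. -/
def contrF (G : Fin n → Fin n → Coord n → ℝ) (F : Fin n → Fin n → Coord n → ℝ)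
    (i j : Fin n) (y : Coord n) : ℝ :=
  ∑ p, ∑ q, ginv G p q y * F i q y * F j p y

/-- `H_{pmn} H^{kmn} = g^{kq} g^{mr} g^{ns} H_{pmn} H_{qrs}`. -/
def mixedH (G : Fin n → Fin n → Coord n → ℝ) (H : Fin n → Fin n → Fin n → Coord n → ℝ)
    (p k : Fin n) (y : Coord n) : ℝ :=
  ∑ m, ∑ l, ∑ q, ∑ r, ∑ s,
    ginv G k q y * ginv G m r y * ginv G l s y * H p m l y * H q r s y

/-- `F_{pm} F^{km} = g^{kq} g^{mr} F_{pm} F_{qr}`. -/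
def mixedF (G : Fin n → Fin n → Coord n → ℝ) (F : Fin n → Fin n → Coord n → ℝ)
    (p k : Fin n) (y : Coord n) : ℝ :=
  ∑ m, ∑ q, ∑ r, ginv G k q y * ginv G m r y * F p m y * F q r y

/-- `∇_k F_i^k = g^{kl} ∇_k F_{il}`. -/
def divF (G : Fin n → Fin n → Coord n → ℝ) (F : Fin n → Fin n → Coord n → ℝ)
    (i : Fin n) (y : Coord n) : ℝ :=
  ∑ k, ∑ l, ginv G k l y * nabla₂ G F k i l y

/-- `∇_k H^k_{ij} = g^{kl} ∇_k H_{lij}`. -/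
def divH (G : Fin n → Fin n → Coord n → ℝ) (H : Fin n → Fin n → Fin n → Coord n → ℝ)
    (i j : Fin n) (y : Coord n) : ℝ :=
  ∑ k, ∑ l, ginv G k l y * nabla₃ G H k l i j y

/-! ### Fields on a manifold and their components in a chart -/

variable {M : Type*} [TopologicalSpace M] [ChartedSpace (Coord n) M]

/-- A 1-form on `M` (no regularity). -/
abbrev OneForm (n : ℕ) (M : Type*) [TopologicalSpace M] [ChartedSpace (Coord n) M] : Type _ :=
  (x : M) → (TangentSpace (𝓡 n) x →L[ℝ] ℝ)

/-- A 2-form on `M` (no regularity). -/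
abbrev TwoForm (n : ℕ) (M : Type*) [TopologicalSpace M] [ChartedSpace (Coord n) M] : Type _ :=
  (x : M) → (TangentSpace (𝓡 n) x [⋀^Fin 2]→L[ℝ] ℝ)

/-- A smooth Riemannian metric on `M`. -/
abbrev Metric (n : ℕ) (M : Type*) [TopologicalSpace M] [ChartedSpace (Coord n) M]
    [IsManifold (𝓡 n) ∞ M] : Type _ :=
  Bundle.ContMDiffRiemannianMetric (𝓡 n) ∞ (Coord n) (fun x : M => TangentSpace (𝓡 n) x)

/-- The coordinate vector field `∂/∂xⁱ` of the chart `φ`, at the point with coordinates `y`. -/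
def coordField (φ : OpenPartialHomeomorph M (Coord n)) (i : Fin n) (y : Coord n) :
    TangentSpace (𝓡 n) (φ.symm y) :=
  mfderiv (𝓡 n) (𝓡 n) φ.symm y (coordVec i)

/-- The components `g_{ij}` of a metric in the chart `φ`. -/
def metricComp [IsManifold (𝓡 n) ∞ M] (φ : OpenPartialHomeomorph M (Coord n))
    (g : Metric n M) (i j : Fin n) (y : Coord n) : ℝ :=
  g.inner (φ.symm y) (coordField φ i y) (coordField φ j y)

/-- The components `A_i` of a 1-form in the chart `φ`. -/
def oneFormComp (φ : OpenPartialHomeomorph M (Coord n)) (A : OneForm n M)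
    (i : Fin n) (y : Coord n) : ℝ :=
  A (φ.symm y) (coordField φ i y)

/-- The components `B_{ij}` of a 2-form in the chart `φ`. -/
def twoFormComp (φ : OpenPartialHomeomorph M (Coord n)) (B : TwoForm n M)
    (i j : Fin n) (y : Coord n) : ℝ :=
  B (φ.symm y) ![coordField φ i y, coordField φ j y]

/-- `(g, A, B)` is a smooth solution on `M × [0,T)` of the coupled flow
`∂_t g_{ij} = -2 (R_{ij} - ¼ H_{ikl} H_j^{kl} - F_i^k F_{jk})`,
`∂_t A_i = -∇_k F_i^k`, `∂_t B_{ij} = ∇_k H^k_{ij}`, with `F = dA` and `H = dB`.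
The fields are smooth in space and time jointly, and the equations hold in every local
coordinate system (every chart of the smooth structure); time derivatives at `t = 0` are
one-sided. -/
structure IsFlow [IsManifold (𝓡 n) ∞ M] (T : ℝ)
    (g : ℝ → Metric n M) (A : ℝ → OneForm n M) (B : ℝ → TwoForm n M) : Prop where
  smooth_g : ∀ φ ∈ IsManifold.maximalAtlas (𝓡 n) ∞ M, ∀ i j,
    ContDiffOn ℝ ∞ (fun p : ℝ × Coord n => metricComp φ (g p.1) i j p.2)
      (Ico 0 T ×ˢ φ.target)
  smooth_A : ∀ φ ∈ IsManifold.maximalAtlas (𝓡 n) ∞ M, ∀ i,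
    ContDiffOn ℝ ∞ (fun p : ℝ × Coord n => oneFormComp φ (A p.1) i p.2)
      (Ico 0 T ×ˢ φ.target)
  smooth_B : ∀ φ ∈ IsManifold.maximalAtlas (𝓡 n) ∞ M, ∀ i j,
    ContDiffOn ℝ ∞ (fun p : ℝ × Coord n => twoFormComp φ (B p.1) i j p.2)
      (Ico 0 T ×ˢ φ.target)
  evol_g : ∀ φ ∈ IsManifold.maximalAtlas (𝓡 n) ∞ M, ∀ t ∈ Ico 0 T, ∀ y ∈ φ.target, ∀ i j,
    HasDerivWithinAt (fun s => metricComp φ (g s) i j y)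
      (-2 * (ricci (metricComp φ (g t)) i j y
        - (1 / 4 : ℝ) *
            contrH (metricComp φ (g t)) (fieldH (twoFormComp φ (B t))) i j y
        - contrF (metricComp φ (g t)) (fieldF (oneFormComp φ (A t))) i j y))
      (Ico 0 T) t
  evol_A : ∀ φ ∈ IsManifold.maximalAtlas (𝓡 n) ∞ M, ∀ t ∈ Ico 0 T, ∀ y ∈ φ.target, ∀ i,
    HasDerivWithinAt (fun s => oneFormComp φ (A s) i y)
      (-divF (metricComp φ (g t)) (fieldF (oneFormComp φ (A t))) i y)
      (Ico 0 T) t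
  evol_B : ∀ φ ∈ IsManifold.maximalAtlas (𝓡 n) ∞ M, ∀ t ∈ Ico 0 T, ∀ y ∈ φ.target, ∀ i j,
    HasDerivWithinAt (fun s => twoFormComp φ (B s) i j y)
      (divH (metricComp φ (g t)) (fieldH (twoFormComp φ (B t))) i j y)
      (Ico 0 T) t

end GaugeRicciFlow

end

/-! The argument is the first variation of scalar curvature combined with the contracted second
Bianchi identity. If `h` is the time derivative of the metric, then `∂R/∂t = ∇^i(∇^j h_{ij} - ∇_i tr
h) - ⟨Ric, h⟩` (`derivation_scal`). This is linear in `h`, and here `h = -2 Ric + ½ HH + 2 FF`. The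
two quadratic tensors pass through unchanged and give the field terms. For the Ricci part, `div Ric
= ½ dR` (`divTensor_ric`) turns the divergence expression into `ΔR`, and the pairing gives
`2|Ric|²`.

All of this is algebra. It uses only that the partial derivatives are commuting derivations, that
time differentiation is a derivation commuting with them, and that the metric is symmetric and
invertible. It is therefore carried out for a `FormalMetric` over a commutative ℝ-algebra, with the
connection and the curvature as matrices `Γ i`, `Ω i j`.

The analysis enters once: smooth functions on `[0,T) × φ.target` form such an algebra, with
one-sided derivatives at `t = 0`. Evaluation at `(t, y)` is an algebra map, which carries each
formal tensor to its coordinate expression (`IsSlice`, `IsMetricSlice`). -/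

noncomputable section

namespace GaugeRicciFlow

/-! ### Tensor calculus over an algebra with commuting derivations -/

section Algebra

variable {ι 𝒜 : Type*} [Fintype ι] [DecidableEq ι] [CommRing 𝒜] [Algebra ℝ 𝒜]

/-- The scalar `1/2`. -/
def half (𝒜 : Type*) [CommRing 𝒜] [Algebra ℝ 𝒜] : 𝒜 := algebraMap ℝ 𝒜 (1 / 2)

theorem two_mul_half : 2 * half 𝒜 = 1 := by
  have h : algebraMap ℝ 𝒜 2 = 2 := map_ofNat _ 2
  rw [half, ← h, ← map_mul]
  norm_num

theorem derivation_half (δ : Derivation ℝ 𝒜 𝒜) : δ (half 𝒜) = 0 :=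
  δ.map_algebraMap _

theorem eq_zero_of_add_self {x : 𝒜} (h : x + x = 0) : x = 0 := by
  linear_combination half 𝒜 * h - x * two_mul_half (𝒜 := 𝒜)

theorem derivation_mul (δ : Derivation ℝ 𝒜 𝒜) (a b : 𝒜) : δ (a * b) = δ a * b + a * δ b := by
  rw [Derivation.leibniz, smul_eq_mul, smul_eq_mul]; ring

omit [DecidableEq ι] in
theorem matrix_map_mul (δ : Derivation ℝ 𝒜 𝒜) (P Q : Matrix ι ι 𝒜) :
    (P * Q).map δ = P.map δ * Q + P * Q.map δ := by
  ext i j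
  simp only [Matrix.map_apply, Matrix.mul_apply, Matrix.add_apply, map_sum, derivation_mul,
    Finset.sum_add_distrib]

omit [Fintype ι] [DecidableEq ι] in
theorem matrix_map_add (δ : Derivation ℝ 𝒜 𝒜) (P Q : Matrix ι ι 𝒜) :
    (P + Q).map δ = P.map δ + Q.map δ := by
  ext i j; simp

omit [Fintype ι] [DecidableEq ι] in
theorem matrix_map_sub (δ : Derivation ℝ 𝒜 𝒜) (P Q : Matrix ι ι 𝒜) :
    (P - Q).map δ = P.map δ - Q.map δ := by
  ext i j; simp

omit [Fintype ι] in
theorem matrix_map_one (δ : Derivation ℝ 𝒜 𝒜) : (1 : Matrix ι ι 𝒜).map δ = 0 := by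
  ext i j
  by_cases h : i = j <;> simp [h]

variable (ι 𝒜) in
/-- The components of a metric and of its inverse, over an algebra with commuting derivations
which play the role of the partial derivatives. -/
structure FormalMetric where
  /-- the partial derivatives -/
  D : ι → Derivation ℝ 𝒜 𝒜
  D_comm : ∀ i j a, D i (D j a) = D j (D i a)
  /-- the metric -/
  g : Matrix ι ι 𝒜
  /-- the inverse metric -/
  u : Matrix ι ι 𝒜
  g_symm : g.transpose = g
  u_mul_g : u * g = 1

namespace FormalMetric

open Matrix

variable (X : FormalMetric ι 𝒜)

theorem g_mul_u : X.g * X.u = 1 := mul_eq_one_comm.mp X.u_mul_g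

theorem g_swap (i j : ι) : X.g i j = X.g j i := congrFun (congrFun X.g_symm j) i

theorem u_symm : X.uᵀ = X.u := by
  have h : X.uᵀ * X.g = 1 := by
    have := congrArg transpose X.g_mul_u
    rwa [transpose_mul, X.g_symm, transpose_one] at this
  calc X.uᵀ = X.uᵀ * (X.g * X.u) := by rw [X.g_mul_u, mul_one]
    _ = X.u := by rw [← mul_assoc, h, one_mul]

theorem u_swap (i j : ι) : X.u i j = X.u j i := congrFun (congrFun X.u_symm j) i

/-- The Christoffel symbols as matrices: `Γ^k_{ij}` is the entry `(k, j)` of `X.Γ i`. -/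
def Γ (i : ι) : Matrix ι ι 𝒜 :=
  of fun k j => half 𝒜 * ∑ l, X.u k l * (X.D i (X.g j l) + X.D j (X.g i l) - X.D l (X.g i j))

theorem Γ_swap (i j k : ι) : X.Γ i k j = X.Γ j k i := by
  simp only [Γ, Matrix.of_apply]
  congr 1
  refine Finset.sum_congr rfl fun l _ => ?_
  rw [X.g_swap i j]; ring

theorem g_mul_Γ (i p j : ι) : (X.g * X.Γ i) p j =
    half 𝒜 * (X.D i (X.g j p) + X.D j (X.g i p) - X.D p (X.g i j)) := by
  have h : X.Γ i = X.u * of fun l j =>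
      half 𝒜 * (X.D i (X.g j l) + X.D j (X.g i l) - X.D l (X.g i j)) := by
    ext k j
    simp only [Γ, Matrix.of_apply, Matrix.mul_apply, Finset.mul_sum]
    exact Finset.sum_congr rfl fun l _ => by ring
  rw [h, ← mul_assoc, X.g_mul_u, one_mul, Matrix.of_apply]

/-- Metric compatibility `∇g = 0`: in the sum of the two Koszul expressions all but `∂_i g` cancels.
-/
theorem map_D_g (i : ι) : X.g.map (X.D i) = X.g * X.Γ i + (X.Γ i)ᵀ * X.g := by
  have h : (X.Γ i)ᵀ * X.g = (X.g * X.Γ i)ᵀ := by rw [transpose_mul, X.g_symm]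
  ext p j
  rw [h, Matrix.add_apply, Matrix.transpose_apply, g_mul_Γ, g_mul_Γ, Matrix.map_apply,
    X.g_swap j p, X.g_swap i p, X.g_swap i j]
  linear_combination -X.D i (X.g p j) * two_mul_half (𝒜 := 𝒜)

theorem map_u (δ : Derivation ℝ 𝒜 𝒜) : X.u.map δ = -(X.u * X.g.map δ * X.u) := by
  have h := matrix_map_mul δ X.u X.g
  rw [X.u_mul_g, matrix_map_one] at h
  calc X.u.map δ = X.u.map δ * (X.g * X.u) := by rw [X.g_mul_u, mul_one]
    _ = (X.u.map δ * X.g + X.u * X.g.map δ) * X.u - X.u * X.g.map δ * X.u := by noncomm_ring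
    _ = _ := by rw [← h]; simp

/-- The inverse metric is parallel as well. This is what lets indices be raised under `∇` below. -/
theorem map_D_u (i : ι) : X.u.map (X.D i) = -(X.Γ i * X.u) - X.u * (X.Γ i)ᵀ := by
  rw [map_u, map_D_g]
  calc _ = -((X.u * X.g) * X.Γ i * X.u) - X.u * (X.Γ i)ᵀ * (X.g * X.u) := by noncomm_ring
    _ = _ := by rw [X.g_mul_u, X.u_mul_g]; simp

/-- The curvature as matrices: `R^k_{ijl}` is the entry `(k, l)` of `X.Ω i j`. -/
def Ω (i j : ι) : Matrix ι ι 𝒜 :=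
  (X.Γ j).map (X.D i) - (X.Γ i).map (X.D j) + (X.Γ i * X.Γ j - X.Γ j * X.Γ i)

theorem Ω_swap (i j : ι) : X.Ω i j = -X.Ω j i := by
  simp only [Ω]; abel

theorem map_D_comm (i j : ι) (P : Matrix ι ι 𝒜) :
    (P.map (X.D i)).map (X.D j) = (P.map (X.D j)).map (X.D i) := by
  ext a b; simp [X.D_comm i j]

omit [Fintype ι] [DecidableEq ι] in
theorem map_transpose (δ : Derivation ℝ 𝒜 𝒜) (P : Matrix ι ι 𝒜) : Pᵀ.map δ = (P.map δ)ᵀ := rfl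

/-- Skew-symmetry of the curvature in its last two indices: expand `∂_i ∂_j g = ∂_j ∂_i g` by metric
compatibility. -/
theorem g_mul_Ω (i j : ι) : X.g * X.Ω i j = -((X.Ω i j)ᵀ * X.g) := by
  have h := X.map_D_comm i j X.g
  rw [X.map_D_g i, X.map_D_g j, matrix_map_add, matrix_map_add, matrix_map_mul, matrix_map_mul,
    matrix_map_mul, matrix_map_mul, X.map_D_g i, X.map_D_g j, map_transpose, map_transpose] at h
  simp only [Ω, transpose_add, transpose_sub, transpose_mul]
  rw [← sub_eq_zero] at h ⊢
  rw [← neg_eq_zero, ← h]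
  noncomm_ring

/-- The second Bianchi identity. -/
theorem bianchi (i j k : ι) :
    ((X.Ω i j).map (X.D k) + X.Γ k * X.Ω i j - X.Ω i j * X.Γ k)
      + ((X.Ω j k).map (X.D i) + X.Γ i * X.Ω j k - X.Ω j k * X.Γ i)
      + ((X.Ω k i).map (X.D j) + X.Γ j * X.Ω k i - X.Ω k i * X.Γ j) = 0 := by
  -- This is the Jacobi identity for the operators `D i + Γ i`. Only the endomorphism indices are
  -- differentiated covariantly; the Christoffel terms of the form indices would cancel in the
  -- cyclic sum.
  simp only [Ω, matrix_map_add, matrix_map_sub, matrix_map_mul]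
  rw [X.map_D_comm k j, X.map_D_comm i k, X.map_D_comm j i]
  noncomm_ring

/-- The Ricci curvature. -/
def ric : Matrix ι ι 𝒜 :=
  of fun i k => ∑ j, ∑ l, X.u j l * ∑ p, X.g k p * X.Ω i j p l

/-- The scalar curvature. -/
def scal : 𝒜 := ∑ i, ∑ j, X.u i j * X.ric i j

/-- Skew-symmetry in both index pairs moves the trace to the first and third indices, where the
metric drops out. -/
theorem ric_eq (j l : ι) : X.ric j l = ∑ i, X.Ω i j i l := by
  have h (i : ι) : ∑ m, X.u i m * ∑ p, X.g l p * X.Ω j i p m = X.Ω i j i l := by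
    have h1 : X.g * X.Ω j i * X.u = (X.Ω i j)ᵀ := by
      rw [g_mul_Ω, X.Ω_swap j i, transpose_neg, neg_mul, neg_mul, neg_mul, neg_neg, mul_assoc,
        X.g_mul_u, mul_one]
    have h2 := congrFun (congrFun h1 l) i
    rw [Matrix.transpose_apply, Matrix.mul_apply] at h2
    rw [← h2]
    refine Finset.sum_congr rfl fun m _ => ?_
    rw [Matrix.mul_apply, X.u_swap, mul_comm]
  simp only [ric, Matrix.of_apply, h]

/-- The curvature with an index raised. -/
def Θ (i j : ι) : Matrix ι ι 𝒜 := X.Ω i j * X.u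

theorem Θ_swap (i j : ι) : X.Θ i j = -X.Θ j i := by rw [Θ, Ω_swap, neg_mul, Θ]

theorem Θ_transpose (i j : ι) : (X.Θ i j)ᵀ = -X.Θ i j := by
  rw [Θ, transpose_mul, X.u_symm]
  have := congrArg (fun P => X.u * P * X.u) (X.g_mul_Ω i j)
  simp only [mul_neg, neg_mul] at this
  rw [← mul_assoc, X.u_mul_g, one_mul, ← mul_assoc, mul_assoc (X.u * _), X.g_mul_u, mul_one] at this
  rw [this, neg_neg]

theorem Θ_skew (i j a b : ι) : X.Θ i j a b = -X.Θ i j b a :=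
  congrFun (congrFun (X.Θ_transpose i j) b) a

theorem sum_Θ (j b : ι) : ∑ i, X.Θ i j i b = (X.ric * X.u) j b := by
  simp only [Θ, Matrix.mul_apply, ric_eq, Finset.sum_mul]
  exact Finset.sum_comm

theorem sum_sum_Θ : ∑ i, ∑ j, X.Θ i j i j = X.scal := by
  rw [Finset.sum_comm]
  simp only [sum_Θ, Matrix.mul_apply, scal]
  refine Finset.sum_congr rfl fun i _ => Finset.sum_congr rfl fun j _ => ?_
  rw [mul_comm, X.u_swap]

/-- Raising an index commutes with `∇`, since `u` is parallel. -/
theorem nabla_mul_u (k : ι) (P : Matrix ι ι 𝒜) :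
    (P.map (X.D k) + X.Γ k * P - P * X.Γ k) * X.u =
      (P * X.u).map (X.D k) + X.Γ k * (P * X.u) + P * X.u * (X.Γ k)ᵀ := by
  rw [matrix_map_mul, map_D_u]; noncomm_ring

theorem bianchi_raised (i j k : ι) :
    ((X.Θ i j).map (X.D k) + X.Γ k * X.Θ i j + X.Θ i j * (X.Γ k)ᵀ)
      + ((X.Θ j k).map (X.D i) + X.Γ i * X.Θ j k + X.Θ j k * (X.Γ i)ᵀ)
      + ((X.Θ k i).map (X.D j) + X.Γ j * X.Θ k i + X.Θ k i * (X.Γ j)ᵀ) = 0 := by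
  have := congrArg (· * X.u) (X.bianchi i j k)
  simp only [add_mul _ _ X.u, nabla_mul_u, zero_mul] at this
  exact this

/-- The covariant derivative `∇_k T` of a covariant 2-tensor, as a matrix. -/
def nabla (T : Matrix ι ι 𝒜) (k : ι) : Matrix ι ι 𝒜 :=
  T.map (X.D k) - ((X.Γ k)ᵀ * T + T * X.Γ k)

/-- The divergence `g^{jl} ∇_l T_{mj}` of a covariant 2-tensor. -/
def divTensor (T : Matrix ι ι 𝒜) (m : ι) : 𝒜 := ∑ j, ∑ l, X.u j l * X.nabla T l m j

/-- The divergence `g^{ip} ∇_i v_p` of a covector. -/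
def div (v : ι → 𝒜) : 𝒜 :=
  ∑ i, ∑ p, X.u i p * (X.D i (v p) - ∑ m, X.Γ i m p * v m)

/-- The trace `g^{ij} T_{ij}`. -/
def tr (T : Matrix ι ι 𝒜) : 𝒜 := ∑ i, ∑ j, X.u i j * T i j

/-- Absorbs the inverse metric into `T`, giving the form in which the contracted Bianchi identity
produces a divergence. -/
theorem divTensor_eq (T : Matrix ι ι 𝒜) (m : ι) :
    X.divTensor T m = ∑ l, (X.D l ((T * X.u) m l) + ∑ p, X.Γ l l p * (T * X.u) m p
      - ∑ p, X.Γ l p m * (T * X.u) p l) := by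
  have h (l : ι) : X.nabla T l * X.u =
      (T * X.u).map (X.D l) + T * X.u * (X.Γ l)ᵀ - (X.Γ l)ᵀ * (T * X.u) := by
    rw [nabla, matrix_map_mul, map_D_u]; noncomm_ring
  rw [divTensor, Finset.sum_comm]
  refine Finset.sum_congr rfl fun l _ => ?_
  have h1 := congrFun (congrFun (h l) m) l
  rw [Matrix.sub_apply, Matrix.add_apply, Matrix.mul_apply, Matrix.mul_apply (M := T * X.u),
    Matrix.mul_apply (M := (X.Γ l)ᵀ)] at h1
  simp only [Matrix.map_apply, Matrix.transpose_apply] at h1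
  calc ∑ j, X.u j l * X.nabla T l m j = ∑ j, X.nabla T l m j * X.u j l :=
        Finset.sum_congr rfl fun _ _ => mul_comm _ _
    _ = _ := h1
    _ = _ := by simp only [mul_comm (X.Γ l l _)]

theorem sum_Γ_mul_skew (i : ι) (P : Matrix ι ι 𝒜) (h : ∀ a b, P a b = -P b a) :
    ∑ a, ∑ b, X.Γ a i b * P a b = 0 := by
  apply eq_zero_of_add_self
  nth_rw 2 [Finset.sum_comm]
  rw [← Finset.sum_add_distrib]
  refine Finset.sum_eq_zero fun a _ => ?_
  rw [← Finset.sum_add_distrib]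
  refine Finset.sum_eq_zero fun b _ => ?_
  rw [X.Γ_swap b, h b a]; ring

/-- The contracted second Bianchi identity. -/
theorem divTensor_ric (m : ι) : X.divTensor X.ric m = half 𝒜 * X.D m X.scal := by
  -- Contract both raised indices with the form indices `i`, `j`. Of the nine resulting sums, `e1`
  -- is `∂_m R`, `e6` and `e8` vanish because `Γ` is symmetric and `Θ` skew, and the other six
  -- combine to `-2 div Ric`.
  have hB : ∑ i, ∑ j, _ = ∑ i, ∑ j, (0 : Matrix ι ι 𝒜) i j :=
    Finset.sum_congr rfl fun i _ => Finset.sum_congr rfl fun j _ =>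
      congrFun (congrFun (X.bianchi_raised i j m) i) j
  simp only [Matrix.add_apply, Finset.sum_add_distrib, Matrix.zero_apply, Finset.sum_const_zero,
    Matrix.mul_apply, Matrix.map_apply, Matrix.transpose_apply] at hB
  have e1 : ∑ i, ∑ j, X.D m (X.Θ i j i j) = X.D m X.scal := by
    simp only [← map_sum, sum_sum_Θ]
  have s2 (i b : ι) : ∑ j, X.Θ i j b j = (X.ric * X.u) i b := by
    rw [← sum_Θ]
    refine Finset.sum_congr rfl fun j _ => ?_
    rw [X.Θ_swap, Matrix.neg_apply, X.Θ_skew, neg_neg]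
  have s3 (i b : ι) : ∑ j, X.Θ j i b j = -(X.ric * X.u) i b := by
    rw [← s2, ← Finset.sum_neg_distrib]
    exact Finset.sum_congr rfl fun j _ => by rw [X.Θ_swap, Matrix.neg_apply]
  have s4 (i b : ι) : ∑ j, X.Θ i j j b = -(X.ric * X.u) i b := by
    rw [← s2, ← Finset.sum_neg_distrib]
    exact Finset.sum_congr rfl fun j _ => by rw [X.Θ_skew]
  have e2 : ∑ i, ∑ j, ∑ p, X.Γ m i p * X.Θ i j p j = ∑ i, ∑ p, X.Γ m i p * (X.ric * X.u) i p := by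
    refine Finset.sum_congr rfl fun i _ => ?_
    rw [Finset.sum_comm]
    simp only [← Finset.mul_sum, s2]
  have e3 : ∑ i, ∑ j, ∑ p, X.Θ i j i p * X.Γ m j p = ∑ i, ∑ p, X.Γ m i p * (X.ric * X.u) i p := by
    rw [Finset.sum_comm]
    refine Finset.sum_congr rfl fun i _ => ?_
    rw [Finset.sum_comm]
    simp only [mul_comm (X.Θ _ _ _ _), ← Finset.mul_sum, sum_Θ]
  have e4 : ∑ i, ∑ j, X.D i (X.Θ j m i j) = -∑ l, X.D l ((X.ric * X.u) m l) := by
    simp only [← map_sum, s3, map_neg, Finset.sum_neg_distrib]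
  have e5 : ∑ i, ∑ j, ∑ p, X.Γ i i p * X.Θ j m p j =
      -∑ l, ∑ p, X.Γ l l p * (X.ric * X.u) m p := by
    rw [← Finset.sum_neg_distrib]
    refine Finset.sum_congr rfl fun i _ => ?_
    rw [Finset.sum_comm, ← Finset.sum_neg_distrib]
    simp only [← Finset.mul_sum, s3, mul_neg]
  have e6 : ∑ i, ∑ j, ∑ p, X.Θ j m i p * X.Γ i j p = 0 := by
    rw [Finset.sum_comm]
    refine Finset.sum_eq_zero fun j _ => ?_
    simp only [mul_comm (X.Θ _ _ _ _)]
    exact X.sum_Γ_mul_skew j _ (X.Θ_skew j m)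
  have e7 : ∑ i, ∑ j, X.D j (X.Θ m i i j) = -∑ l, X.D l ((X.ric * X.u) m l) := by
    rw [Finset.sum_comm]
    simp only [← map_sum, s4, map_neg, Finset.sum_neg_distrib]
  have e8 : ∑ i, ∑ j, ∑ p, X.Γ j i p * X.Θ m i p j = 0 := by
    refine Finset.sum_eq_zero fun i _ => ?_
    have := X.sum_Γ_mul_skew i (X.Θ m i)ᵀ fun a b => X.Θ_skew m i b a
    simpa only [Matrix.transpose_apply] using this
  have e9 : ∑ i, ∑ j, ∑ p, X.Θ m i i p * X.Γ j j p =
      -∑ l, ∑ p, X.Γ l l p * (X.ric * X.u) m p := by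
    rw [Finset.sum_comm, ← Finset.sum_neg_distrib]
    refine Finset.sum_congr rfl fun j _ => ?_
    rw [Finset.sum_comm, ← Finset.sum_neg_distrib]
    simp only [mul_comm (X.Θ _ _ _ _), ← Finset.mul_sum, s4, mul_neg]
  have e10 : ∑ l, ∑ p, X.Γ l p m * (X.ric * X.u) p l =
      ∑ i, ∑ p, X.Γ m i p * (X.ric * X.u) i p := by
    rw [Finset.sum_comm]
    refine Finset.sum_congr rfl fun i _ => Finset.sum_congr rfl fun p _ => ?_
    rw [X.Γ_swap]
  rw [e1, e2, e3, e4, e5, e6, e7, e8, e9] at hB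
  rw [divTensor_eq, Finset.sum_sub_distrib, Finset.sum_add_distrib, e10]
  linear_combination (-half 𝒜) * hB - two_mul_half (𝒜 := 𝒜) * (
    (∑ l, X.D l ((X.ric * X.u) m l)) + (∑ l, ∑ p, X.Γ l l p * (X.ric * X.u) m p)
      - ∑ i, ∑ p, X.Γ m i p * (X.ric * X.u) i p)

end FormalMetric

end Algebra

/-! ### First variation of the curvature and evolution of the scalar curvature. -/

section Variation

variable {ι 𝒜 : Type*} [Fintype ι] [DecidableEq ι] [CommRing 𝒜] [Algebra ℝ 𝒜]

namespace FormalMetric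

open Matrix

variable (X : FormalMetric ι 𝒜)

theorem tr_eq_trace (T : Matrix ι ι 𝒜) : X.tr T = (X.u * T).trace := by
  rw [tr, Finset.sum_comm]
  refine Finset.sum_congr rfl fun j _ => ?_
  rw [diag_apply, Matrix.mul_apply]
  exact Finset.sum_congr rfl fun i _ => by rw [X.u_swap]

omit [DecidableEq ι] in
theorem derivation_trace (δ : Derivation ℝ 𝒜 𝒜) (T : Matrix ι ι 𝒜) :
    δ T.trace = (T.map δ).trace := by
  simp [trace]

/-- The covariant derivative commutes with the trace. -/
theorem tr_nabla (T : Matrix ι ι 𝒜) (i : ι) : X.tr (X.nabla T i) = X.D i (X.tr T) := by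
  rw [tr_eq_trace, tr_eq_trace, derivation_trace, matrix_map_mul, map_D_u, nabla, mul_sub, mul_add,
    sub_mul, neg_mul, trace_sub, trace_add, trace_add, trace_sub, trace_neg,
    mul_assoc (X.Γ i), trace_mul_comm (X.Γ i), mul_assoc, mul_assoc]
  ring

/-- The divergence of a vector field. -/
def divVec (v : ι → 𝒜) : 𝒜 := ∑ i, (X.D i (v i) + ∑ p, X.Γ i i p * v p)

/-- Again because the inverse metric is parallel. -/
theorem divVec_raise (v : ι → 𝒜) : X.divVec (fun i => ∑ p, X.u i p * v p) = X.div v := by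
  refine Finset.sum_congr rfl fun i _ => ?_
  have hu (p : ι) : X.D i (X.u i p) =
      -(∑ m, X.Γ i i m * X.u m p) - ∑ m, X.u i m * X.Γ i p m := by
    have := congrFun (congrFun (X.map_D_u i) i) p
    simpa only [Matrix.sub_apply, Matrix.neg_apply, Matrix.mul_apply, Matrix.map_apply,
      Matrix.transpose_apply] using this
  have e1 : ∑ p, (∑ m, X.Γ i i m * X.u m p) * v p = ∑ p, X.Γ i i p * ∑ m, X.u p m * v m := by
    simp only [Finset.sum_mul, Finset.mul_sum]
    rw [Finset.sum_comm]
    exact Finset.sum_congr rfl fun _ _ => Finset.sum_congr rfl fun _ _ => by ring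
  have e2 : ∑ p, (∑ m, X.u i m * X.Γ i p m) * v p = ∑ p, X.u i p * ∑ m, X.Γ i m p * v m := by
    simp only [Finset.sum_mul, Finset.mul_sum]
    rw [Finset.sum_comm]
    exact Finset.sum_congr rfl fun _ _ => Finset.sum_congr rfl fun _ _ => by ring
  simp only [map_sum, derivation_mul, hu, sub_mul, neg_mul, Finset.sum_add_distrib,
    Finset.sum_sub_distrib, Finset.sum_neg_distrib, mul_sub, e1, e2]
  ring

variable (τ : Derivation ℝ 𝒜 𝒜)

/-- The variation of the Christoffel symbols, with the upper index lowered. -/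
theorem g_mul_map_Γ (hτ : ∀ i a, τ (X.D i a) = X.D i (τ a)) (i p j : ι) :
    (X.g * (X.Γ i).map τ) p j = half 𝒜 *
      (X.nabla (X.g.map τ) i j p + X.nabla (X.g.map τ) j i p - X.nabla (X.g.map τ) p i j) := by
  set h := X.g.map τ with hh
  have hs (a b : ι) : h a b = h b a := by simp only [hh, Matrix.map_apply, X.g_swap a b]
  -- Apply `τ` to the Koszul formula for `g Γ`. The term `(τ g) Γ` supplies the Christoffel
  -- corrections that turn the partial derivatives of `τ g` into covariant ones.
  have h1 := congrFun (congrFun (matrix_map_mul τ X.g (X.Γ i)) p) j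
  rw [Matrix.add_apply, Matrix.map_apply, g_mul_Γ, derivation_mul, derivation_half, map_sub,
    map_add, hτ, hτ, hτ] at h1
  have e1 (a b c : ι) : X.nabla h a b c =
      X.D a (h b c) - ((∑ m, X.Γ a m b * h m c) + ∑ m, X.Γ a m c * h m b) := by
    rw [nabla, Matrix.sub_apply, Matrix.add_apply, Matrix.mul_apply, Matrix.mul_apply]
    simp only [Matrix.transpose_apply, Matrix.map_apply, hs b, mul_comm (h _ b)]
  have e2 : (h * X.Γ i) p j = ∑ m, X.Γ i m j * h m p := by
    rw [Matrix.mul_apply]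
    exact Finset.sum_congr rfl fun m _ => by rw [hs, mul_comm]
  rw [e2] at h1
  rw [e1, e1, e1]
  simp only [hs i j, X.Γ_swap j i, X.Γ_swap p i, X.Γ_swap p j] at h1 ⊢
  have e3 (a b : ι) : τ (X.g a b) = h a b := rfl
  simp only [e3, hs j p, hs i p, hs i j] at h1 ⊢
  simp only [hs j i, hs p i, hs p j] at h1 ⊢
  linear_combination (∑ m, X.Γ i m j * h m p) * two_mul_half (𝒜 := 𝒜) - h1

theorem nabla_swap {T : Matrix ι ι 𝒜} (hT : ∀ a b, T a b = T b a) (i a b : ι) :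
    X.nabla T i a b = X.nabla T i b a := by
  rw [nabla, Matrix.sub_apply, Matrix.sub_apply, Matrix.add_apply, Matrix.add_apply,
    Matrix.mul_apply, Matrix.mul_apply, Matrix.mul_apply, Matrix.mul_apply]
  simp only [Matrix.transpose_apply, Matrix.map_apply]
  rw [hT a b, add_comm]
  congr 2 <;> exact Finset.sum_congr rfl fun m _ => by rw [hT, mul_comm]

theorem sum_u_swap (f : ι → ι → 𝒜) :
    ∑ i, ∑ p, X.u i p * f i p = ∑ i, ∑ p, X.u i p * f p i := by
  rw [Finset.sum_comm]
  exact Finset.sum_congr rfl fun i _ => Finset.sum_congr rfl fun p _ => by rw [X.u_swap]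

theorem eq_u_mul_g_mul (P : Matrix ι ι 𝒜) : P = X.u * (X.g * P) := by
  rw [← mul_assoc, X.u_mul_g, one_mul]

/-- In the trace over the upper and a lower index, the first and third terms of the varied Koszul
formula cancel by symmetry. -/
theorem sum_map_Γ (hτ : ∀ i a, τ (X.D i a) = X.D i (τ a)) (l : ι) :
    ∑ i, (X.Γ i).map τ i l = half 𝒜 * X.D l (X.tr (X.g.map τ)) := by
  have hs (a b : ι) : X.g.map τ a b = X.g.map τ b a := by
    simp only [Matrix.map_apply, X.g_swap a b]
  have h1 : ∑ i, (X.Γ i).map τ i l =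
      half 𝒜 * ∑ i, ∑ p, (X.u i p * X.nabla (X.g.map τ) i l p
        + X.u i p * X.nabla (X.g.map τ) l i p - X.u i p * X.nabla (X.g.map τ) p i l) := by
    rw [Finset.mul_sum]
    refine Finset.sum_congr rfl fun i _ => ?_
    rw [X.eq_u_mul_g_mul ((X.Γ i).map τ), Matrix.mul_apply, Finset.mul_sum]
    refine Finset.sum_congr rfl fun p _ => ?_
    rw [g_mul_map_Γ X τ hτ]; ring
  rw [h1]
  simp only [Finset.sum_add_distrib, Finset.sum_sub_distrib]
  rw [X.sum_u_swap fun i p => X.nabla (X.g.map τ) p i l, ← tr_nabla, tr]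
  simp only [X.nabla_swap hs _ l]
  ring

/-- In the trace over the two lower indices, the first two Koszul terms agree and give the
divergence. -/
theorem sum_sum_map_Γ (hτ : ∀ i a, τ (X.D i a) = X.D i (τ a)) (i : ι) :
    ∑ j, ((X.Γ j).map τ * X.u) i j =
      ∑ p, X.u i p *
        (X.divTensor (X.g.map τ) p - half 𝒜 * X.D p (X.tr (X.g.map τ))) := by
  have hs (a b : ι) : X.g.map τ a b = X.g.map τ b a := by
    simp only [Matrix.map_apply, X.g_swap a b]
  have h1 (p : ι) : ∑ j, ∑ l, (X.g * (X.Γ j).map τ) p l * X.u l j =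
      X.divTensor (X.g.map τ) p - half 𝒜 * X.D p (X.tr (X.g.map τ)) := by
    have : ∑ j, ∑ l, (X.g * (X.Γ j).map τ) p l * X.u l j =
        half 𝒜 * ∑ j, ∑ l, (X.u j l * X.nabla (X.g.map τ) j l p
        + X.u j l * X.nabla (X.g.map τ) l j p - X.u j l * X.nabla (X.g.map τ) p j l) := by
      simp only [Finset.mul_sum]
      refine Finset.sum_congr rfl fun j _ => Finset.sum_congr rfl fun l _ => ?_
      rw [g_mul_map_Γ X τ hτ, X.u_swap]; ring
    rw [this]
    simp only [Finset.sum_add_distrib, Finset.sum_sub_distrib]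
    rw [X.sum_u_swap fun j l => X.nabla (X.g.map τ) j l p, ← tr_nabla, tr, divTensor]
    simp only [X.nabla_swap hs _ _ p]
    linear_combination (∑ j, ∑ l, X.u j l * X.nabla (X.g.map τ) l p j) * two_mul_half (𝒜 := 𝒜)
  simp only [← h1]
  calc _ = ∑ j, (X.u * (X.g * (X.Γ j).map τ * X.u)) i j := by
        simp only [← mul_assoc, X.u_mul_g, one_mul]
    _ = ∑ p, ∑ j, X.u i p * (X.g * (X.Γ j).map τ * X.u) p j := by
        rw [Finset.sum_comm]; simp only [Matrix.mul_apply (M := X.u)]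
    _ = _ := by simp only [Finset.mul_sum, Matrix.mul_apply (N := X.u)]

theorem div_add (v w : ι → 𝒜) : X.div (fun p => v p + w p) = X.div v + X.div w := by
  simp only [div, ← Finset.sum_add_distrib]
  refine Finset.sum_congr rfl fun i _ => Finset.sum_congr rfl fun p _ => ?_
  simp only [map_add, mul_add, Finset.sum_add_distrib]
  ring

theorem div_smul (r : ℝ) (v : ι → 𝒜) : X.div (fun p => r • v p) = r • X.div v := by
  simp only [div, Derivation.map_smul, mul_smul_comm, ← Finset.smul_sum, ← smul_sub]

theorem div_sub (v w : ι → 𝒜) : X.div (fun p => v p - w p) = X.div v - X.div w := by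
  have := X.div_add (fun p => v p - w p) w
  simp only [sub_add_cancel] at this
  rw [this, add_sub_cancel_right]

/-- The operator `g^{ik} g^{jl} (∇_i ∇_l T_{kj} - ∇_i ∇_k T_{jl})`. -/
def hessTrace (T : Matrix ι ι 𝒜) : 𝒜 := X.div fun m => X.divTensor T m - X.D m (X.tr T)

/-- The pairing `T_{ik} g^{ip} g^{kq} S_{pq}`. -/
def pairing (T S : Matrix ι ι 𝒜) : 𝒜 := ∑ i, ∑ k, T i k * (X.u * S * X.u) i k

/-- The Palatini identity `δΩ_{ij} = ∇_i δΓ_j - ∇_j δΓ_i`, with an index raised. The corrections for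
the remaining lower index cancel by symmetry of `Γ` and are omitted. -/
theorem map_Ω_mul_u (hτ : ∀ i a, τ (X.D i a) = X.D i (τ a)) (i j : ι) :
    (X.Ω i j).map τ * X.u =
      (((X.Γ j).map τ * X.u).map (X.D i) + X.Γ i * ((X.Γ j).map τ * X.u)
          + (X.Γ j).map τ * X.u * (X.Γ i)ᵀ)
        - (((X.Γ i).map τ * X.u).map (X.D j) + X.Γ j * ((X.Γ i).map τ * X.u)
          + (X.Γ i).map τ * X.u * (X.Γ j)ᵀ) := by
  have hc (k : ι) (P : Matrix ι ι 𝒜) : (P.map (X.D k)).map τ = (P.map τ).map (X.D k) := by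
    ext a b; simp [hτ]
  rw [← nabla_mul_u, ← nabla_mul_u, ← sub_mul]
  congr 1
  simp only [Ω, matrix_map_add, matrix_map_sub, matrix_map_mul, hc]
  noncomm_ring

/-- The variation of the scalar curvature. -/
theorem derivation_scal (hτ : ∀ i a, τ (X.D i a) = X.D i (τ a)) :
    τ X.scal = X.hessTrace (X.g.map τ) - X.pairing X.ric (X.g.map τ) := by
  -- The product rule on `R = (Ω_{ij} u)^{ij}`: varying `u` yields the Ricci pairing, varying `Ω`
  -- yields a divergence.
  have h1 : τ X.scal = ∑ i, ∑ j, ((X.Ω i j).map τ * X.u) i j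
      - ∑ i, ∑ j, (X.Ω i j * (X.u * X.g.map τ * X.u)) i j := by
    simp only [← sum_sum_Θ, map_sum, ← Finset.sum_sub_distrib]
    refine Finset.sum_congr rfl fun i _ => Finset.sum_congr rfl fun j _ => ?_
    have := congrFun (congrFun (matrix_map_mul τ (X.Ω i j) X.u) i) j
    rw [map_u, mul_neg, ← sub_eq_add_neg] at this
    exact this
  have h2 : ∑ i, ∑ j, (X.Ω i j * (X.u * X.g.map τ * X.u)) i j =
      X.pairing X.ric (X.g.map τ) := by
    have hs : (X.u * X.g.map τ * X.u)ᵀ = X.u * X.g.map τ * X.u := by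
      rw [transpose_mul, transpose_mul, X.u_symm, ← map_transpose, X.g_symm, mul_assoc]
    rw [pairing, Finset.sum_comm]
    refine Finset.sum_congr rfl fun j _ => ?_
    simp only [Matrix.mul_apply (M := X.Ω _ _), ric_eq, Finset.sum_mul]
    rw [Finset.sum_comm]
    refine Finset.sum_congr rfl fun l _ => Finset.sum_congr rfl fun i _ => ?_
    rw [← congrFun (congrFun hs l) j, Matrix.transpose_apply]
  have h3 : ∑ i, ∑ j, ((X.Ω i j).map τ * X.u) i j =
      X.divVec (fun i => ∑ j, ((X.Γ j).map τ * X.u) i j)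
        - X.divVec (fun j => ∑ i, ((X.Γ i).map τ * X.u) i j) := by
    simp only [map_Ω_mul_u X τ hτ, Matrix.sub_apply, Matrix.add_apply, Matrix.map_apply,
      Matrix.mul_apply (M := X.Γ _), Matrix.mul_apply (N := (X.Γ _)ᵀ), Matrix.transpose_apply,
      Finset.sum_sub_distrib, Finset.sum_add_distrib, divVec, map_sum]
    have e1 : ∑ i, ∑ j, ∑ p, X.Γ i i p * ((X.Γ j).map τ * X.u) p j =
        ∑ i, ∑ p, X.Γ i i p * ∑ j, ((X.Γ j).map τ * X.u) p j := by
      refine Finset.sum_congr rfl fun i _ => ?_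
      rw [Finset.sum_comm]
      simp only [Finset.mul_sum]
    have e2 : ∑ i, ∑ j, ∑ p, ((X.Γ i).map τ * X.u) i p * X.Γ j j p =
        ∑ j, ∑ p, X.Γ j j p * ∑ i, ((X.Γ i).map τ * X.u) i p := by
      rw [Finset.sum_comm]
      refine Finset.sum_congr rfl fun j _ => ?_
      rw [Finset.sum_comm]
      simp only [mul_comm (X.Γ j j _), Finset.sum_mul]
    have e3 : ∑ i, ∑ j, ∑ p, ((X.Γ j).map τ * X.u) i p * X.Γ i j p =
        ∑ i, ∑ j, ∑ p, X.Γ j i p * ((X.Γ i).map τ * X.u) p j := by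
      calc _ = ∑ j, ∑ i, ∑ p, X.Γ p j i * ((X.Γ j).map τ * X.u) i p := by
            rw [Finset.sum_comm]
            refine Finset.sum_congr rfl fun j _ => Finset.sum_congr rfl fun i _ =>
              Finset.sum_congr rfl fun p _ => ?_
            rw [mul_comm, X.Γ_swap]
        _ = _ := Finset.sum_congr rfl fun j _ => Finset.sum_comm
    have e4 : ∑ i, ∑ j, X.D j (((X.Γ i).map τ * X.u) i j) =
        ∑ j, ∑ i, X.D j (((X.Γ i).map τ * X.u) i j) := Finset.sum_comm
    rw [e1, e2, e3, e4]
    ring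
  have h4 (j : ι) : ∑ i, ((X.Γ i).map τ * X.u) i j =
      ∑ p, X.u j p * (half 𝒜 * X.D p (X.tr (X.g.map τ))) := by
    simp only [Matrix.mul_apply, ← sum_map_Γ X τ hτ]
    rw [Finset.sum_comm]
    refine Finset.sum_congr rfl fun p _ => ?_
    rw [Finset.mul_sum]
    exact Finset.sum_congr rfl fun i _ => by rw [X.u_swap, mul_comm]
  rw [h1, h2, h3]
  simp only [sum_sum_map_Γ X τ hτ, h4]
  rw [divVec_raise, divVec_raise, hessTrace, ← div_sub]
  congr 2
  ext m
  -- Each of the two traces of `δΓ` contributes half of `d tr h`.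
  linear_combination (-X.D m (X.tr (X.g.map τ))) * two_mul_half (𝒜 := 𝒜)

/-- The second covariant derivative `∇_i ∇_l T_{kj}`. -/
def nablaSq (T : Matrix ι ι 𝒜) (i l k j : ι) : 𝒜 :=
  X.D i (X.nabla T l k j) - ∑ m, (X.Γ i m l * X.nabla T m k j + X.Γ i m k * X.nabla T l m j
    + X.Γ i m j * X.nabla T l k m)

theorem nabla_entry (T : Matrix ι ι 𝒜) (k i j : ι) : X.nabla T k i j =
    X.D k (T i j) - ∑ m, (X.Γ k m i * T m j + X.Γ k m j * T i m) := by
  simp only [nabla, Matrix.sub_apply, Matrix.add_apply, Matrix.mul_apply, Matrix.transpose_apply,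
    Matrix.map_apply, Finset.sum_add_distrib, mul_comm (T i _)]

/-- Since the trace commutes with `∇`, both parts of `hessTrace` become full contractions of second
covariant derivatives. -/
theorem div_tr (W : ι → Matrix ι ι 𝒜) : X.div (fun k => X.tr (W k)) =
    ∑ i, ∑ j, ∑ k, ∑ l, X.u j l * X.u i k *
      (X.nabla (W k) i j l - ∑ m, X.Γ i m k * W m j l) := by
  refine Finset.sum_congr rfl fun i _ => ?_
  rw [Finset.sum_comm]
  refine Finset.sum_congr rfl fun k _ => ?_
  have h (m : ι) : X.Γ i m k * X.tr (W m) =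
      ∑ j, ∑ l, X.u j l * (X.Γ i m k * W m j l) := by
    simp only [tr, Finset.mul_sum]
    exact Finset.sum_congr rfl fun _ _ => Finset.sum_congr rfl fun _ _ => by ring
  rw [← tr_nabla]
  simp only [h]
  rw [Finset.sum_comm, tr, ← Finset.sum_sub_distrib, Finset.mul_sum]
  refine Finset.sum_congr rfl fun j _ => ?_
  rw [Finset.sum_comm, ← Finset.sum_sub_distrib, Finset.mul_sum]
  refine Finset.sum_congr rfl fun l _ => ?_
  rw [← Finset.mul_sum]
  ring

theorem hessTrace_eq (T : Matrix ι ι 𝒜) : X.hessTrace T =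
    ∑ i, ∑ j, ∑ k, ∑ l, X.u j l * X.u i k * (X.nablaSq T i l k j - X.nablaSq T i k j l) := by
  have h1 : X.div (X.divTensor T) =
      ∑ i, ∑ j, ∑ k, ∑ l, X.u j l * X.u i k * X.nablaSq T i l k j := by
    refine (X.div_tr fun k => of fun j l => X.nabla T l k j).trans ?_
    refine Finset.sum_congr rfl fun i _ => Finset.sum_congr rfl fun j _ =>
      Finset.sum_congr rfl fun k _ => Finset.sum_congr rfl fun l _ => ?_
    rw [nabla_entry, nablaSq]
    simp only [Matrix.of_apply, Finset.sum_add_distrib]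
    ring
  have h2 : X.div (fun m => X.D m (X.tr T)) =
      ∑ i, ∑ j, ∑ k, ∑ l, X.u j l * X.u i k * X.nablaSq T i k j l := by
    simp only [← tr_nabla]
    refine (X.div_tr fun k => X.nabla T k).trans ?_
    refine Finset.sum_congr rfl fun i _ => Finset.sum_congr rfl fun j _ =>
      Finset.sum_congr rfl fun k _ => Finset.sum_congr rfl fun l _ => ?_
    rw [nabla_entry, nablaSq]
    simp only [Finset.sum_add_distrib]
    ring
  rw [hessTrace, div_sub, h1, h2]
  simp only [← Finset.sum_sub_distrib, ← mul_sub]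

theorem nabla_add (T S : Matrix ι ι 𝒜) (k i j : ι) :
    X.nabla (T + S) k i j = X.nabla T k i j + X.nabla S k i j := by
  simp only [nabla_entry, Matrix.add_apply, map_add, mul_add, Finset.sum_add_distrib]
  ring

theorem nabla_smul (r : ℝ) (T : Matrix ι ι 𝒜) (k i j : ι) :
    X.nabla (r • T) k i j = r • X.nabla T k i j := by
  simp only [nabla_entry, Matrix.smul_apply, Derivation.map_smul, mul_smul_comm, ← smul_add,
    ← Finset.smul_sum, ← smul_sub]

theorem hessTrace_add (T S : Matrix ι ι 𝒜) :
    X.hessTrace (T + S) = X.hessTrace T + X.hessTrace S := by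
  rw [hessTrace, hessTrace, hessTrace, ← div_add]
  congr 1
  ext m
  simp only [divTensor, tr, nabla_add, Matrix.add_apply, mul_add, Finset.sum_add_distrib, map_add]
  ring

theorem hessTrace_smul (r : ℝ) (T : Matrix ι ι 𝒜) :
    X.hessTrace (r • T) = r • X.hessTrace T := by
  rw [hessTrace, hessTrace, ← div_smul]
  congr 1
  ext m
  simp only [divTensor, tr, nabla_smul, Matrix.smul_apply, mul_smul_comm, ← Finset.smul_sum,
    Derivation.map_smul, smul_sub]

theorem pairing_add (P T S : Matrix ι ι 𝒜) :
    X.pairing P (T + S) = X.pairing P T + X.pairing P S := by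
  simp only [pairing, mul_add, add_mul, Matrix.add_apply, Finset.sum_add_distrib]

theorem pairing_smul (r : ℝ) (P T : Matrix ι ι 𝒜) :
    X.pairing P (r • T) = r • X.pairing P T := by
  simp only [pairing, mul_smul_comm, smul_mul_assoc, Matrix.smul_apply, Finset.smul_sum]

theorem pairing_eq (P T : Matrix ι ι 𝒜) :
    X.pairing P T = ∑ i, ∑ p, ∑ k, X.u i p * P i k * ∑ q, X.u k q * T p q := by
  refine Finset.sum_congr rfl fun i _ => ?_
  rw [Finset.sum_comm]
  refine Finset.sum_congr rfl fun k _ => ?_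
  rw [mul_assoc, Matrix.mul_apply, Finset.mul_sum]
  refine Finset.sum_congr rfl fun p _ => ?_
  rw [Matrix.mul_apply, Finset.mul_sum, Finset.mul_sum, Finset.mul_sum]
  exact Finset.sum_congr rfl fun q _ => by rw [X.u_swap k q]; ring

/-- The Laplacian of a function. -/
def lap (f : 𝒜) : 𝒜 := ∑ i, ∑ j, X.u i j * (X.D i (X.D j f) - ∑ k, X.Γ i k j * X.D k f)

/-- The contracted Bianchi identity gives `div Ric - dR = -½ dR`, and the factor `-2` of the flow
normalizes this to `dR`. -/
theorem hessTrace_ric : (-2 : ℝ) • X.hessTrace X.ric = X.lap X.scal := by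
  have h : ∀ m, X.divTensor X.ric m - X.D m (X.tr X.ric) = (-(1 / 2) : ℝ) • X.D m X.scal := by
    intro m
    have h1 : X.tr X.ric = X.scal := rfl
    rw [divTensor_ric, h1, half, ← Algebra.smul_def]
    module
  rw [hessTrace]
  simp only [h]
  rw [div_smul, smul_smul]
  norm_num
  rfl

/-- The evolution of the scalar curvature when the metric evolves by minus twice the Ricci
curvature plus an arbitrary combination of 2-tensors. -/
theorem derivation_scal_of_flow (hτ : ∀ i a, τ (X.D i a) = X.D i (τ a)) (P Q : Matrix ι ι 𝒜)
    (hg : ∀ i j, τ (X.g i j) =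
      (-2 : ℝ) • (X.ric i j - (1 / 4 : ℝ) • P i j - Q i j)) :
    τ X.scal = X.lap X.scal + (2 : ℝ) • X.pairing X.ric X.ric
      + (1 / 2 : ℝ) • X.hessTrace P + (2 : ℝ) • X.hessTrace Q
      - ((1 / 2 : ℝ) • X.pairing X.ric P + (2 : ℝ) • X.pairing X.ric Q) := by
  have h : X.g.map τ = (-2 : ℝ) • X.ric + (1 / 2 : ℝ) • P + (2 : ℝ) • Q := by
    ext i j
    simp only [Matrix.map_apply, hg, Matrix.add_apply, Matrix.smul_apply]
    module
  rw [derivation_scal X τ hτ, h]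
  simp only [hessTrace_add, hessTrace_smul, pairing_add, pairing_smul, hessTrace_ric]
  module

end FormalMetric

end Variation

/-! ### The algebra of smooth functions on a set, and its directional derivatives -/

section SmoothAlgebra

variable {E : Type*} [NormedAddCommGroup E] [NormedSpace ℝ E]

/-- The extension by zero of a function on `U`. -/
def zeroExt {U : Set E} (f : U → ℝ) : E → ℝ := Function.extend Subtype.val f 0

omit [NormedAddCommGroup E] [NormedSpace ℝ E] in
theorem zeroExt_apply {U : Set E} (f : U → ℝ) {x : E} (hx : x ∈ U) : zeroExt f x = f ⟨x, hx⟩ :=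
  Subtype.val_injective.extend_apply f 0 ⟨x, hx⟩

/-- The algebra of smooth functions on `U`. -/
def smoothAlgebra (U : Set E) : Subalgebra ℝ (U → ℝ) where
  -- Elements live on `U` itself, so agreement on `U` is equality; the extension only provides a
  -- function on `E` to differentiate within `U`.
  carrier := {f | ContDiffOn ℝ ∞ (zeroExt f) U}
  mul_mem' {f g} hf hg := (ContDiffOn.mul hf hg).congr fun x hx => by
    simp only [Pi.mul_apply, zeroExt_apply _ hx]
  add_mem' {f g} hf hg := (ContDiffOn.add hf hg).congr fun x hx => by
    simp only [Pi.add_apply, zeroExt_apply _ hx]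
  algebraMap_mem' r := (contDiffOn_const (c := r)).congr fun x hx => by
    rw [zeroExt_apply _ hx]; rfl

variable {U : Set E}

/-- The element of `smoothAlgebra U` given by a function which is smooth on `U`. -/
def smoothAlgebra.mk (f : E → ℝ) (hf : ContDiffOn ℝ ∞ f U) : smoothAlgebra U :=
  ⟨fun x => f x, hf.congr fun x hx => by rw [zeroExt_apply _ hx]⟩

/-- Evaluation at a point of `U`. -/
def evalAt (x : E) (hx : x ∈ U) : smoothAlgebra U →ₐ[ℝ] ℝ :=
  (Pi.evalAlgHom ℝ (fun _ : U => ℝ) ⟨x, hx⟩).comp (smoothAlgebra U).val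

theorem evalAt_mk (f : E → ℝ) (hf : ContDiffOn ℝ ∞ f U) (x : E) (hx : x ∈ U) :
    evalAt x hx (smoothAlgebra.mk f hf) = f x := rfl

theorem zeroExt_eq_evalAt (a : smoothAlgebra U) {x : E} (hx : x ∈ U) :
    zeroExt (a : U → ℝ) x = evalAt x hx a := zeroExt_apply _ hx

theorem smoothAlgebra.ext_evalAt {a b : smoothAlgebra U}
    (h : ∀ x hx, evalAt x hx a = evalAt x hx b) : a = b :=
  Subtype.ext (funext fun x => h x x.2)

theorem smoothAlgebra.hasFDerivWithinAt (a : smoothAlgebra U) {x : E} (hx : x ∈ U) :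
    HasFDerivWithinAt (zeroExt (a : U → ℝ)) (fderivWithin ℝ (zeroExt (a : U → ℝ)) U x) U x :=
  ((a.2.differentiableOn (by simp)) x hx).hasFDerivWithinAt

theorem smoothAlgebra.contDiffOn_fderivWithin (hU : UniqueDiffOn ℝ U) (a : smoothAlgebra U) :
    ContDiffOn ℝ ∞ (fderivWithin ℝ (zeroExt (a : U → ℝ)) U) U :=
  ContDiffOn.fderivWithin a.2 hU (by simp)

/-- The directional derivative, as a derivation of the algebra of smooth functions. -/
def dirDeriv (hU : UniqueDiffOn ℝ U) (v : E) : Derivation ℝ (smoothAlgebra U) (smoothAlgebra U) :=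
  Derivation.mk'
    { toFun := fun a => smoothAlgebra.mk (fun x => fderivWithin ℝ (zeroExt (a : U → ℝ)) U x v)
        ((smoothAlgebra.contDiffOn_fderivWithin hU a).clm_apply contDiffOn_const)
      map_add' := fun a b => smoothAlgebra.ext_evalAt fun x hx => by
        have h : HasFDerivWithinAt (zeroExt ((a + b : smoothAlgebra U) : U → ℝ)) _ U x :=
          ((smoothAlgebra.hasFDerivWithinAt a hx).add (smoothAlgebra.hasFDerivWithinAt b hx)).congr
            (fun y hy => by simp only [Pi.add_apply, zeroExt_eq_evalAt _ hy, map_add])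
            (by simp only [Pi.add_apply, zeroExt_eq_evalAt _ hx, map_add])
        rw [map_add, evalAt_mk, evalAt_mk, evalAt_mk, h.fderivWithin (hU x hx)]
        rfl
      map_smul' := fun r a => smoothAlgebra.ext_evalAt fun x hx => by
        have h : HasFDerivWithinAt (zeroExt ((r • a : smoothAlgebra U) : U → ℝ)) _ U x :=
          ((smoothAlgebra.hasFDerivWithinAt a hx).const_smul r).congr
            (fun y hy => by simp only [Pi.smul_apply, zeroExt_eq_evalAt _ hy, map_smul])
            (by simp only [Pi.smul_apply, zeroExt_eq_evalAt _ hx, map_smul])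
        rw [RingHom.id_apply, map_smul, evalAt_mk, evalAt_mk, h.fderivWithin (hU x hx)]
        rfl }
    fun a b => smoothAlgebra.ext_evalAt fun x hx => by
      have h : HasFDerivWithinAt (zeroExt ((a * b : smoothAlgebra U) : U → ℝ)) _ U x :=
        ((smoothAlgebra.hasFDerivWithinAt a hx).mul (smoothAlgebra.hasFDerivWithinAt b hx)).congr
          (fun y hy => by simp only [Pi.mul_apply, zeroExt_eq_evalAt _ hy, map_mul])
          (by simp only [Pi.mul_apply, zeroExt_eq_evalAt _ hx, map_mul])
      simp only [LinearMap.coe_mk, AddHom.coe_mk, map_add, smul_eq_mul, map_mul, evalAt_mk]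
      rw [h.fderivWithin (hU x hx), zeroExt_eq_evalAt _ hx, zeroExt_eq_evalAt _ hx]
      rfl

theorem evalAt_dirDeriv (hU : UniqueDiffOn ℝ U) (v : E) (a : smoothAlgebra U) (x : E)
    (hx : x ∈ U) : evalAt x hx (dirDeriv hU v a) = fderivWithin ℝ (zeroExt (a : U → ℝ)) U x v :=
  rfl

/-- Symmetry of the second derivative within `U`. It persists at boundary points that are limits of
interior points, which covers `t = 0`. -/
theorem dirDeriv_comm (hU : UniqueDiffOn ℝ U) (hU' : U ⊆ closure (interior U)) (v w : E)
    (a : smoothAlgebra U) : dirDeriv hU v (dirDeriv hU w a) = dirDeriv hU w (dirDeriv hU v a) := by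
  refine smoothAlgebra.ext_evalAt fun x hx => ?_
  have key (v w : E) : evalAt x hx (dirDeriv hU v (dirDeriv hU w a)) =
      fderivWithin ℝ (fderivWithin ℝ (zeroExt (a : U → ℝ)) U) U x v w := by
    have h1 : HasFDerivWithinAt (fderivWithin ℝ (zeroExt (a : U → ℝ)) U)
        (fderivWithin ℝ (fderivWithin ℝ (zeroExt (a : U → ℝ)) U) U x) U x :=
      (((smoothAlgebra.contDiffOn_fderivWithin hU a).differentiableOn
        (by simp)) x hx).hasFDerivWithinAt
    have h2 : HasFDerivWithinAt (zeroExt (dirDeriv hU w a : U → ℝ)) _ U x :=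
      (h1.clm_apply (hasFDerivWithinAt_const w x U)).congr
        (fun y hy => by rw [zeroExt_eq_evalAt _ hy, evalAt_dirDeriv])
        (by rw [zeroExt_eq_evalAt _ hx, evalAt_dirDeriv])
    rw [evalAt_dirDeriv, h2.fderivWithin (hU x hx)]
    simp
  rw [key, key]
  exact ((a.2 x hx).isSymmSndFDerivWithinAt
    (by simpa using WithTop.coe_le_coe.mpr (le_top : (2 : ℕ∞) ≤ ⊤)) hU (hU' hx) hx) v w

end SmoothAlgebra

/-! ### Functions of time and of the coordinates -/

section Slices

variable {n : ℕ} {I : Set ℝ} {O : Set (Coord n)}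

/-- The function `f` on the coordinate space is the slice at time `t` of the smooth function
`a` of time and of the coordinates. -/
def IsSlice (t : ℝ) (f : Coord n → ℝ) (a : smoothAlgebra (I ×ˢ O)) : Prop :=
  ∀ y (hy : (t, y) ∈ I ×ˢ O), f y = evalAt (t, y) hy a

/-- The chain rule along `z ↦ (t, z)`; as `O` is open, the derivative within `O` is the ordinary one
used by `pd`. -/
theorem IsSlice.pd {t : ℝ} {f : Coord n → ℝ} {a : smoothAlgebra (I ×ˢ O)} (h : IsSlice t f a)
    (hO : IsOpen O) (hU : UniqueDiffOn ℝ (I ×ˢ O)) (i : Fin n) :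
    IsSlice t (pd i f) (dirDeriv hU (0, coordVec i) a) := by
  intro y hy
  have h1 := (smoothAlgebra.hasFDerivWithinAt a hy).comp y
    ((hasFDerivAt_prodMk_right t y).hasFDerivWithinAt (s := O)) fun z hz => ⟨hy.1, hz⟩
  have h2 := (h1.congr (f₁ := f)
    (fun z hz => by rw [h z ⟨hy.1, hz⟩, Function.comp_apply,
      zeroExt_eq_evalAt a (mk_mem_prod hy.1 hz)])
    (by rw [h y hy, Function.comp_apply, zeroExt_eq_evalAt a hy])).hasFDerivAt (hO.mem_nhds hy.2)
  rw [GaugeRicciFlow.pd, h2.fderiv, evalAt_dirDeriv]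
  rfl

theorem hasDerivWithinAt_slice {f : ℝ → ℝ} {a : smoothAlgebra (I ×ˢ O)}
    (hU : UniqueDiffOn ℝ (I ×ˢ O)) {t : ℝ} {y : Coord n} (hy : (t, y) ∈ I ×ˢ O)
    (h : ∀ s (hs : s ∈ I), f s = evalAt (s, y) (mk_mem_prod hs hy.2) a) :
    HasDerivWithinAt f (evalAt (t, y) hy (dirDeriv hU (1, 0) a)) I t := by
  have h1 := (smoothAlgebra.hasFDerivWithinAt a hy).comp t
    ((hasFDerivAt_prodMk_left (𝕜 := ℝ) t y).hasFDerivWithinAt (s := I))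
    fun z hz => mk_mem_prod hz hy.2
  have h2 := (h1.congr (f₁ := f)
    (fun s hs => by rw [h s hs, Function.comp_apply, zeroExt_eq_evalAt a (mk_mem_prod hs hy.2)])
    (by rw [h t hy.1, Function.comp_apply, zeroExt_eq_evalAt a hy])).hasDerivWithinAt
  exact h2

variable {t : ℝ} {X : FormalMetric (Fin n) (smoothAlgebra (I ×ˢ O))}
  {G : Fin n → Fin n → Coord n → ℝ}

/-- `G` is the slice at time `t` of the time-dependent metric `X`. -/
structure IsMetricSlice (t : ℝ) (G : Fin n → Fin n → Coord n → ℝ)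
    (X : FormalMetric (Fin n) (smoothAlgebra (I ×ˢ O))) : Prop where
  metric : ∀ i j, IsSlice t (G i j) (X.g i j)
  pd : ∀ f a, IsSlice t f a → ∀ i, IsSlice t (pd i f) (X.D i a)

namespace IsMetricSlice

variable (hG : IsMetricSlice t G X)
include hG

/-- Evaluating `u * g = 1` exhibits a left inverse of the metric matrix, and inverses are unique. -/
theorem ginv (i j : Fin n) : IsSlice t (ginv G i j) (X.u i j) := by
  intro y hy
  have h : (Matrix.of fun a b => G a b y) = X.g.map (evalAt (t, y) hy) := by
    ext a b; exact hG.metric a b y hy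
  rw [GaugeRicciFlow.ginv, h, Matrix.inv_eq_left_inv (B := X.u.map (evalAt (t, y) hy))]
  · rfl
  · rw [← Matrix.map_mul, X.u_mul_g, Matrix.map_one _ (map_zero _) (map_one _)]

theorem christoffel (k i j : Fin n) : IsSlice t (christoffel G k i j) (X.Γ i k j) := by
  intro y hy
  have h (i j l : Fin n) := hG.pd _ _ (hG.metric j l) i y hy
  have h' (i j : Fin n) := hG.ginv i j y hy
  simp only [GaugeRicciFlow.christoffel, FormalMetric.Γ, Matrix.of_apply, half, map_mul, map_sum,
    map_add, map_sub, AlgHom.commutes, Algebra.algebraMap_self, RingHom.id_apply, h, h']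

theorem riemannUp (k i j l : Fin n) : IsSlice t (riemannUp G k i j l) (X.Ω i j k l) := by
  intro y hy
  have h (m k i j : Fin n) := hG.pd _ _ (hG.christoffel k i j) m y hy
  have h' (k i j : Fin n) := hG.christoffel k i j y hy
  simp only [GaugeRicciFlow.riemannUp, FormalMetric.Ω, Matrix.add_apply, Matrix.sub_apply,
    Matrix.map_apply, Matrix.mul_apply, Finset.sum_sub_distrib, map_mul, map_sum,
    map_add, map_sub, h, h']

theorem ricci (i k : Fin n) : IsSlice t (ricci G i k) (X.ric i k) := by
  intro y hy
  have h (i j : Fin n) := hG.ginv i j y hy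
  have h' (k i j l : Fin n) := hG.riemannUp k i j l y hy
  have h'' (i j : Fin n) := hG.metric i j y hy
  simp only [GaugeRicciFlow.ricci, riemann, FormalMetric.ric, Matrix.of_apply, map_mul, map_sum,
    h, h', h'']

theorem scalarCurv : IsSlice t (scalarCurv G) X.scal := by
  intro y hy
  have h (i j : Fin n) := hG.ginv i j y hy
  have h' (i j : Fin n) := hG.ricci i j y hy
  simp only [GaugeRicciFlow.scalarCurv, FormalMetric.scal, map_mul, map_sum, h, h']

theorem laplacian {f : Coord n → ℝ} {a : smoothAlgebra (I ×ˢ O)} (hf : IsSlice t f a) :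
    IsSlice t (laplacian G f) (X.lap a) := by
  intro y hy
  have h (i j : Fin n) := hG.ginv i j y hy
  have h' (i : Fin n) := hG.pd _ _ hf i y hy
  have h'' (i j : Fin n) := hG.pd _ _ (hG.pd _ _ hf i) j y hy
  have h3 (k i j : Fin n) := hG.christoffel k i j y hy
  simp only [GaugeRicciFlow.laplacian, FormalMetric.lap, map_mul, map_sum, map_sub, h, h', h'', h3]

variable {S : Fin n → Fin n → Coord n → ℝ} {T : Matrix (Fin n) (Fin n) (smoothAlgebra (I ×ˢ O))}

theorem nabla₂ (hS : ∀ i j, IsSlice t (S i j) (T i j)) (k i j : Fin n) :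
    IsSlice t (nabla₂ G S k i j) (X.nabla T k i j) := by
  intro y hy
  have h (k i j : Fin n) := hG.pd _ _ (hS i j) k y hy
  have h' (k i j : Fin n) := hG.christoffel k i j y hy
  have h'' (i j : Fin n) := hS i j y hy
  simp only [GaugeRicciFlow.nabla₂, FormalMetric.nabla_entry, map_mul, map_sum, map_sub, map_add,
    h, h', h'']

theorem nablaNabla (hS : ∀ i j, IsSlice t (S i j) (T i j)) (i l k j : Fin n) :
    IsSlice t (nablaNabla G S i l k j) (X.nablaSq T i l k j) := by
  intro y hy
  have h (i l k j : Fin n) := hG.pd _ _ (hG.nabla₂ hS l k j) i y hy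
  have h' (k i j : Fin n) := hG.christoffel k i j y hy
  have h'' (l k j : Fin n) := hG.nabla₂ hS l k j y hy
  simp only [GaugeRicciFlow.nablaNabla, nabla₃, FormalMetric.nablaSq, map_mul, map_sum, map_sub,
    map_add, h, h', h'']

theorem fieldF {A : Fin n → Coord n → ℝ} {a : Fin n → smoothAlgebra (I ×ˢ O)}
    (hA : ∀ i, IsSlice t (A i) (a i)) (i j : Fin n) :
    IsSlice t (fieldF A i j) (X.D i (a j) - X.D j (a i)) := by
  intro y hy
  have h (i j : Fin n) := hG.pd _ _ (hA j) i y hy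
  simp only [GaugeRicciFlow.fieldF, map_sub, h]

theorem fieldH {B : Fin n → Fin n → Coord n → ℝ} {b : Fin n → Fin n → smoothAlgebra (I ×ˢ O)}
    (hB : ∀ i j, IsSlice t (B i j) (b i j)) (i j k : Fin n) :
    IsSlice t (fieldH B i j k) (X.D i (b j k) + X.D j (b k i) + X.D k (b i j)) := by
  intro y hy
  have h (i j k : Fin n) := hG.pd _ _ (hB j k) i y hy
  simp only [GaugeRicciFlow.fieldH, map_add, h]

theorem contrF {F : Fin n → Fin n → Coord n → ℝ} {f : Fin n → Fin n → smoothAlgebra (I ×ˢ O)}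
    (hF : ∀ i j, IsSlice t (F i j) (f i j)) (i j : Fin n) :
    IsSlice t (contrF G F i j) (∑ p, ∑ q, X.u p q * f i q * f j p) := by
  intro y hy
  have h (i j : Fin n) := hG.ginv i j y hy
  have h' (i j : Fin n) := hF i j y hy
  simp only [GaugeRicciFlow.contrF, map_mul, map_sum, h, h']

theorem contrH {H : Fin n → Fin n → Fin n → Coord n → ℝ}
    {f : Fin n → Fin n → Fin n → smoothAlgebra (I ×ˢ O)}
    (hH : ∀ i j k, IsSlice t (H i j k) (f i j k)) (i j : Fin n) :
    IsSlice t (contrH G H i j)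
      (∑ p, ∑ q, ∑ r, ∑ s, X.u p r * X.u q s * f i p q * f j r s) := by
  intro y hy
  have h (i j : Fin n) := hG.ginv i j y hy
  have h' (i j k : Fin n) := hH i j k y hy
  simp only [GaugeRicciFlow.contrH, map_mul, map_sum, h, h']

end IsMetricSlice

end Slices

/-! ### Index bookkeeping for the field terms and invertibility of the metric. -/

theorem mixedH_eq {n : ℕ} (G : Fin n → Fin n → Coord n → ℝ)
    (H : Fin n → Fin n → Fin n → Coord n → ℝ) (p k : Fin n) (y : Coord n) :
    mixedH G H p k y = ∑ q, ginv G k q y * contrH G H p q y := by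
  simp only [mixedH, contrH, Finset.mul_sum]
  rw [Finset.sum_congr rfl fun m _ => Finset.sum_comm]
  rw [Finset.sum_comm]
  refine Finset.sum_congr rfl fun q _ => ?_
  ring_nf

theorem mixedF_eq {n : ℕ} (G : Fin n → Fin n → Coord n → ℝ) {y : Coord n}
    (hG : ∀ i j, ginv G i j y = ginv G j i y)
    (F : Fin n → Fin n → Coord n → ℝ) (p k : Fin n) :
    mixedF G F p k y = ∑ q, ginv G k q y * contrF G F p q y := by
  simp only [mixedF, contrF, Finset.mul_sum]
  rw [Finset.sum_comm]
  refine Finset.sum_congr rfl fun q _ => ?_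
  rw [Finset.sum_comm]
  refine Finset.sum_congr rfl fun r _ => Finset.sum_congr rfl fun m _ => ?_
  rw [hG m r]; ring

/-- A kernel vector `v` would give the tangent vector `∑ v_j ∂_j` of zero length; it is nonzero
because the differential of `φ.symm` is injective, contradicting positivity. -/
theorem det_metricComp_ne_zero {n : ℕ} {M : Type*} [TopologicalSpace M] [ChartedSpace (Coord n) M]
    [IsManifold (𝓡 n) ∞ M] (g : Metric n M) {φ : OpenPartialHomeomorph M (Coord n)}
    (hφ : φ ∈ IsManifold.maximalAtlas (𝓡 n) ∞ M) {y : Coord n} (hy : y ∈ φ.target) :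
    (Matrix.of fun i j => metricComp φ g i j y).det ≠ 0 := by
  intro h0
  obtain ⟨v, hv, hv0⟩ := Matrix.exists_mulVec_eq_zero_iff.mpr h0
  have hφd : φ.MDifferentiable (𝓡 n) (𝓡 n) :=
    ⟨(contMDiffOn_of_mem_maximalAtlas hφ).mdifferentiableOn (by simp),
      (contMDiffOn_symm_of_mem_maximalAtlas hφ).mdifferentiableOn (by simp)⟩
  let L : Coord n →L[ℝ] TangentSpace (𝓡 n) (φ.symm y) := mfderiv (𝓡 n) (𝓡 n) φ.symm y
  have hinj : Function.Injective L := hφd.symm.mfderiv_injective (x := y) hy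
  set w : Coord n := ∑ j, v j • coordVec j with hw
  have hLw : L w = ∑ j, v j • coordField φ j y := by
    rw [hw, map_sum]
    exact Finset.sum_congr rfl fun j _ => map_smul L _ _
  have hw0 : w ≠ 0 := by
    intro h
    refine hv (funext fun i => ?_)
    have := congrArg (fun z : Coord n => z i) h
    simpa [hw, coordVec, Pi.single_apply] using this
  have hLw0 : L w ≠ 0 := fun h => hw0 (hinj (by rw [h, map_zero]))
  have hpos := g.pos (φ.symm y) (L w) hLw0
  have : g.inner (φ.symm y) (L w) (L w) =
      ∑ i, v i * ((Matrix.of fun i j => metricComp φ g i j y).mulVec v) i := by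
    rw [hLw]
    simp only [map_sum, map_smul, sum_apply, smul_apply,
      smul_eq_mul, Matrix.mulVec, dotProduct, Matrix.of_apply, Finset.mul_sum, metricComp]
    rw [Finset.sum_comm]
    refine Finset.sum_congr rfl fun i _ => Finset.sum_congr rfl fun j _ => ?_
    ring
  rw [this, hv0] at hpos
  simp at hpos

theorem subset_closure_interior_Ico_prod {F : Type*} [TopologicalSpace F] (T : ℝ) {O : Set F}
    (hO : IsOpen O) : Ico 0 T ×ˢ O ⊆ closure (interior (Ico 0 T ×ˢ O)) := by
  rw [interior_prod_eq, closure_prod_eq, hO.interior_eq, interior_Ico]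
  rintro ⟨t, y⟩ ⟨ht, hy⟩
  refine ⟨?_, subset_closure hy⟩
  have h : 0 < T := ht.1.trans_lt ht.2
  rw [closure_Ioo h.ne]
  exact Ico_subset_Icc_self ht

/-- Applied to the determinant of the metric, this places the inverse metric in the algebra of
smooth functions. -/
theorem isUnit_of_evalAt_ne_zero {E : Type*} [NormedAddCommGroup E] [NormedSpace ℝ E] {U : Set E}
    {a : smoothAlgebra U} (h : ∀ x hx, evalAt x hx a ≠ 0) : IsUnit a := by
  have ha : ContDiffOn ℝ ∞ (zeroExt (a : U → ℝ)) U := a.2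
  refine IsUnit.of_mul_eq_one (smoothAlgebra.mk (fun x => (zeroExt (a : U → ℝ) x)⁻¹)
    (ha.inv fun x hx => by rw [zeroExt_eq_evalAt a hx]; exact h x hx)) ?_
  refine smoothAlgebra.ext_evalAt fun x hx => ?_
  rw [map_mul, evalAt_mk, map_one, zeroExt_eq_evalAt a hx, mul_inv_cancel₀ (h x hx)]

/-! ### The metric of a flow as a formal metric. -/

section Flow

variable {n : ℕ} {M : Type*} [TopologicalSpace M] [ChartedSpace (Coord n) M]
  [IsManifold (𝓡 n) ∞ M] {T : ℝ} {g : ℝ → Metric n M} {A : ℝ → OneForm n M} {B : ℝ → TwoForm n M}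
  {φ : OpenPartialHomeomorph M (Coord n)}

omit [ChartedSpace (Coord n) M] [IsManifold (𝓡 n) ∞ M] in
theorem uniqueDiffOn_Ico_prod (T : ℝ) (φ : OpenPartialHomeomorph M (Coord n)) :
    UniqueDiffOn ℝ (Ico 0 T ×ˢ φ.target) :=
  (uniqueDiffOn_Ico 0 T).prod φ.open_target.uniqueDiffOn

/-- The components of the metric of a flow, as functions of time and of the coordinates. -/
def IsFlow.metricMatrix (hflow : IsFlow T g A B) (hφ : φ ∈ IsManifold.maximalAtlas (𝓡 n) ∞ M) :
    Matrix (Fin n) (Fin n) (smoothAlgebra (Ico 0 T ×ˢ φ.target)) :=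
  Matrix.of fun i j => smoothAlgebra.mk _ (hflow.smooth_g φ hφ i j)

theorem IsFlow.isUnit_det (hflow : IsFlow T g A B) (hφ : φ ∈ IsManifold.maximalAtlas (𝓡 n) ∞ M) :
    IsUnit (hflow.metricMatrix hφ).det := by
  refine isUnit_of_evalAt_ne_zero fun x hx => ?_
  rw [AlgHom.map_det]
  exact det_metricComp_ne_zero (g x.1) hφ hx.2

/-- The metric of a flow in a chart. -/
def IsFlow.formalMetric (hflow : IsFlow T g A B) (hφ : φ ∈ IsManifold.maximalAtlas (𝓡 n) ∞ M) :
    FormalMetric (Fin n) (smoothAlgebra (Ico 0 T ×ˢ φ.target)) where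
  D i := dirDeriv (uniqueDiffOn_Ico_prod T φ) (0, coordVec i)
  D_comm i j a := dirDeriv_comm _ (subset_closure_interior_Ico_prod T φ.open_target) _ _ a
  g := hflow.metricMatrix hφ
  u := (hflow.metricMatrix hφ)⁻¹
  g_symm := by
    refine Matrix.ext fun i j => smoothAlgebra.ext_evalAt fun x _ => ?_
    exact (g x.1).symm _ _ _
  u_mul_g := Matrix.nonsing_inv_mul _ (hflow.isUnit_det hφ)

theorem IsFlow.isMetricSlice (hflow : IsFlow T g A B)
    (hφ : φ ∈ IsManifold.maximalAtlas (𝓡 n) ∞ M) (t : ℝ) :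
    IsMetricSlice t (metricComp φ (g t)) (hflow.formalMetric hφ) where
  metric _ _ _ _ := rfl
  pd _ _ h i := h.pd φ.open_target (uniqueDiffOn_Ico_prod T φ) i

end Flow

end GaugeRicciFlow

end
-- Transfer of the algebraic evolution formula to the flow.
open GaugeRicciFlow in
theorem theorem5p3 {n : ℕ} {M : Type*} [TopologicalSpace M]
    [ChartedSpace (GaugeRicciFlow.Coord n) M] [IsManifold (𝓡 n) ∞ M]
    (T : ℝ) (g : ℝ → GaugeRicciFlow.Metric n M)
    (A : ℝ → GaugeRicciFlow.OneForm n M) (B : ℝ → GaugeRicciFlow.TwoForm n M)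
    (hflow : GaugeRicciFlow.IsFlow T g A B)
    (φ : OpenPartialHomeomorph M (GaugeRicciFlow.Coord n))
    (hφ : φ ∈ IsManifold.maximalAtlas (𝓡 n) ∞ M)
    (t : ℝ) (ht : t ∈ Ico 0 T) (y : GaugeRicciFlow.Coord n) (hy : y ∈ φ.target) :
    let G := GaugeRicciFlow.metricComp φ (g t)
    let F := GaugeRicciFlow.fieldF (GaugeRicciFlow.oneFormComp φ (A t))
    let H := GaugeRicciFlow.fieldH (GaugeRicciFlow.twoFormComp φ (B t))
    let gi := fun i j => GaugeRicciFlow.ginv G i j y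
    HasDerivWithinAt
      (fun s => GaugeRicciFlow.scalarCurv (GaugeRicciFlow.metricComp φ (g s)) y)
      (GaugeRicciFlow.laplacian G (GaugeRicciFlow.scalarCurv G) y
        + 2 * GaugeRicciFlow.ricciNormSq G y
        + (1 / 2 : ℝ) * ∑ i, ∑ j, ∑ k, ∑ l, gi j l * gi i k *
            (GaugeRicciFlow.nablaNabla G (GaugeRicciFlow.contrH G H) i l k j y
              - GaugeRicciFlow.nablaNabla G (GaugeRicciFlow.contrH G H) i k j l y)
        + 2 * ∑ i, ∑ j, ∑ k, ∑ l, gi j l * gi i k *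
            (GaugeRicciFlow.nablaNabla G (GaugeRicciFlow.contrF G F) i l k j y
              - GaugeRicciFlow.nablaNabla G (GaugeRicciFlow.contrF G F) i k j l y)
        - ∑ i, ∑ p, ∑ k, gi i p * GaugeRicciFlow.ricci G i k y *
            ((1 / 2 : ℝ) * GaugeRicciFlow.mixedH G H p k y
              + 2 * GaugeRicciFlow.mixedF G F p k y))
      (Ico 0 T) t := by
  intro G F H gi
  have hU := uniqueDiffOn_Ico_prod T φ
  have hty : (t, y) ∈ Ico 0 T ×ˢ φ.target := ⟨ht, hy⟩
  set X := hflow.formalMetric hφ with hX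
  set τ := dirDeriv hU (1, 0) with hτ
  let a i := smoothAlgebra.mk _ (hflow.smooth_A φ hφ i)
  let b i j := smoothAlgebra.mk _ (hflow.smooth_B φ hφ i j)
  let f i j := X.D i (a j) - X.D j (a i)
  let h i j k := X.D i (b j k) + X.D j (b k i) + X.D k (b i j)
  let Q : Matrix (Fin n) (Fin n) (smoothAlgebra (Ico 0 T ×ˢ φ.target)) :=
    Matrix.of fun i j => ∑ p, ∑ q, X.u p q * f i q * f j p
  let P : Matrix (Fin n) (Fin n) (smoothAlgebra (Ico 0 T ×ˢ φ.target)) :=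
    Matrix.of fun i j => ∑ p, ∑ q, ∑ r, ∑ s, X.u p r * X.u q s * h i p q * h j r s
  have hM (s : ℝ) := hflow.isMetricSlice hφ s
  have hF (s : ℝ) i j : IsSlice s (fieldF (oneFormComp φ (A s)) i j) (f i j) :=
    (hM s).fieldF (fun i y hy => rfl) i j
  have hH (s : ℝ) i j k : IsSlice s (fieldH (twoFormComp φ (B s)) i j k) (h i j k) :=
    (hM s).fieldH (fun i j y hy => rfl) i j k
  have hQ (s : ℝ) i j : IsSlice s (contrF (metricComp φ (g s))
      (fieldF (oneFormComp φ (A s))) i j) (Q i j) := (hM s).contrF (hF s) i j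
  have hP (s : ℝ) i j : IsSlice s (contrH (metricComp φ (g s))
      (fieldH (twoFormComp φ (B s))) i j) (P i j) := (hM s).contrH (hH s) i j
  -- The flow equation as an identity in the algebra: at each point both sides are derivatives
  -- within `[0,T)` of the same function, and these are unique, also at `t = 0`.
  have hflowX : ∀ i j, τ (X.g i j) =
      (-2 : ℝ) • (X.ric i j - (1 / 4 : ℝ) • P i j - Q i j) := by
    refine fun i j => smoothAlgebra.ext_evalAt fun x hx => ?_
    have h1 := hasDerivWithinAt_slice hU hx
      (f := fun s => metricComp φ (g s) i j x.2) (a := X.g i j) fun s hs => rfl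
    have h2 := hflow.evol_g φ hφ x.1 hx.1 x.2 hx.2 i j
    rw [hτ, (uniqueDiffOn_Ico 0 T x.1 hx.1).eq_deriv _ h1 h2, (hM x.1).ricci i j x.2 hx,
      hP x.1 i j x.2 hx, hQ x.1 i j x.2 hx]
    simp only [map_smul, map_sub, smul_eq_mul]
    rfl
  have hscal := hasDerivWithinAt_slice hU hty
    (f := fun s => scalarCurv (metricComp φ (g s)) y) (a := X.scal)
    fun s hs => (hM s).scalarCurv y ⟨hs, hy⟩
  -- Differentiability is settled; what remains is to identify the value of `τ X.scal` at `(t, y)`.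
  convert hscal using 1
  rw [← hτ, X.derivation_scal_of_flow τ
    (fun i a => dirDeriv_comm hU (subset_closure_interior_Ico_prod T φ.open_target) _ _ a) P Q
    hflowX]
  have eu (i j : Fin n) : ginv G i j y = evalAt (t, y) hty (X.u i j) := (hM t).ginv i j y hty
  have er (i j : Fin n) : ricci G i j y = evalAt (t, y) hty (X.ric i j) :=
    (hM t).ricci i j y hty
  have eP (i j : Fin n) : contrH G H i j y = evalAt (t, y) hty (P i j) := hP t i j y hty
  have eQ (i j : Fin n) : contrF G F i j y = evalAt (t, y) hty (Q i j) := hQ t i j y hty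
  have eL : laplacian G (scalarCurv G) y = evalAt (t, y) hty (X.lap X.scal) :=
    (hM t).laplacian (hM t).scalarCurv y hty
  have eP2 (i l k j : Fin n) : nablaNabla G (contrH G H) i l k j y =
      evalAt (t, y) hty (X.nablaSq P i l k j) := (hM t).nablaNabla (hP t) i l k j y hty
  have eQ2 (i l k j : Fin n) : nablaNabla G (contrF G F) i l k j y =
      evalAt (t, y) hty (X.nablaSq Q i l k j) := (hM t).nablaNabla (hQ t) i l k j y hty
  have hsymm (i j : Fin n) : ginv G i j y = ginv G j i y := by rw [eu, eu, X.u_swap]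
  have eRic : ricciNormSq G y = evalAt (t, y) hty (X.pairing X.ric X.ric) := by
    have : X.pairing X.ric X.ric =
        ∑ i, ∑ j, ∑ k, ∑ l, X.u i k * X.u j l * X.ric i j * X.ric k l := by
      rw [X.pairing_eq]
      refine Finset.sum_congr rfl fun i _ => ?_
      rw [Finset.sum_comm]
      simp only [Finset.mul_sum]
      refine Finset.sum_congr rfl fun j _ => Finset.sum_congr rfl fun k _ =>
        Finset.sum_congr rfl fun l _ => ?_
      ring
    rw [this]
    simp only [ricciNormSq, map_sum, map_mul, eu, er]
  simp only [map_add, map_sub, map_smul, smul_eq_mul, X.hessTrace_eq, X.pairing_eq X.ric P,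
    X.pairing_eq X.ric Q, ← eL, ← eRic, mixedH_eq, mixedF_eq G hsymm, gi, eu, er, eP, eQ, eP2, eQ2,
    map_sum, map_mul]
  -- Only the Ricci pairings with `P` and `Q` still differ in form: they have to be merged into one
  -- sum over `i`, `p`, `k`.
  congr 1
  simp only [Finset.mul_sum (a := (1 / 2 : ℝ)), Finset.mul_sum (a := (2 : ℝ)),
    ← Finset.sum_add_distrib]
  refine Finset.sum_congr rfl fun i _ => Finset.sum_congr rfl fun p _ =>
    Finset.sum_congr rfl fun k _ => ?_
  rw [Finset.sum_add_distrib, ← Finset.mul_sum, ← Finset.mul_sum]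
  ring
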